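/- A plane map is a cellular embedding of a finite connected graph (loops and multiple edges allowed) into the sphere, considered up to orientation-preserving homeomorphism. Equivalently, and this is the form used here, a plane map with $n\ge 1$ edges is an isomorphism class of pairs $(\sigma,\alpha)$ of permutations of a set of $2n$ oriented edges, where $\alpha$ (reversal) is an involution without fixed points, $\sigma$ (rotation around the origin) is such that $\sigma$ and $\alpha$ generate a transitive group, and $\#V+\#F=n+2$, where the set of vertices $V$ is the set of cycles of $\sigma$ and the set of faces $F$ is the set of cycles of $\sigma^{-1}\alpha$. A rooted map is a plane map with a distinguished oriented edge; a rooted pointed map is a rooted map with, in addition, a distinguished vertex. In both cases isomorphisms preserve the distinguished elements. For $n\ge 1$ let $\mathcal M_n$ be the (finite) set of rooted plane maps with $n$ edges, $\mathcal M_n^\bullet$ the set of rooted pointed plane maps with $n$ edges, $\mu_n$ the uniform probability measure on $\mathcal M_n$, and $\mu_n^\bullet$ the image of the uniform probability measure on $\mathcal M_n^\bullet$ under the map $\mathcal M_n^\bullet\to\mathcal M_n$ that forgets the distinguished vertex. Let $\|\cdot\|$ denote the total variation norm of signed measures. Then $$\|\mu_n-\mu_n^\bullet\|\longrightarrow 0\qquad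 (n\to\infty).$$ Moreover, if $M_n$ has law $\mu_n$ and $V(M_n)$ is its set of vertices, then $2\,\#V(M_n)/n\to 1$ in $L^2$, that is, $$E\left[\left(\frac{2\,\#V(M_n)}{n}-1\right)^2\right]\longrightarrow 0\qquad (n\to\infty).$$ -/

import Mathlib

open MeasureTheory ProbabilityTheory Filter Topology

/-- The set of cycles of a permutation, fixed points counting as cycles of length one. -/
abbrev Cycles {D : Type*} (σ : Equiv.Perm D) : Type _ :=
  Quotient (Equiv.Perm.SameCycle.setoid σ)

/-- A plane map (a cellular embedding of a graph into the oriented sphere, loops and multiple edges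
allowed, considered up to orientation-preserving homeomorphism) with at least one edge, whose
oriented edges are labelled by `D`, in its usual encoding by permutations.
`next e` is the oriented edge that follows `e` in counterclockwise order around the origin of `e`,
and `rev e` is the reverse of `e`. The graph is connected, and the surface obtained by gluing discs
to the faces is the sphere by Euler's formula. -/
structure PlaneMap (D : Type*) where
  next : Equiv.Perm D
  rev : Equiv.Perm D
  rev_rev : ∀ e, rev (rev e) = e
  rev_ne : ∀ e, rev e ≠ e
  connected : MulAction.IsPretransitive (Subgroup.closure {next, rev}) D
  /-- `#V + #F = #E + 2`; the permutation `next⁻¹ * rev` sends an oriented edge to the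
  one that follows it along the face lying to its left. -/
  euler : Nat.card (Cycles next) + Nat.card (Cycles (next⁻¹ * rev)) = Nat.card (Cycles rev) + 2

namespace PlaneMap

variable {D : Type*}

/-- The vertices of a plane map: the cycles of oriented edges around a common origin. -/
abbrev Vertex (m : PlaneMap D) : Type _ := Cycles m.next

/-- The origin of an oriented edge. -/
def origin (m : PlaneMap D) (e : D) : m.Vertex := Quotient.mk _ e

/-- `f` relabels the oriented edges of `m` into those of `m'`: it is an isomorphism from
`m` to `m'`, that is, the two labelled maps agree up to orientation-preserving homeomorphism. -/
def IsIso (m m' : PlaneMap D) (f : Equiv.Perm D) : Prop :=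
  (∀ e, f (m.next e) = m'.next (f e)) ∧ ∀ e, f (m.rev e) = m'.rev (f e)

theorem IsIso.refl (m : PlaneMap D) : IsIso m m 1 := ⟨fun _ => rfl, fun _ => rfl⟩

theorem IsIso.symm {m m' : PlaneMap D} {f : Equiv.Perm D} (h : IsIso m m' f) :
    IsIso m' m f⁻¹ := by
  constructor
  · intro e
    rw [Equiv.Perm.inv_eq_iff_eq, h.1]
    simp
  · intro e
    rw [Equiv.Perm.inv_eq_iff_eq, h.2]
    simp

theorem IsIso.trans {m m' m'' : PlaneMap D} {f g : Equiv.Perm D} (h : IsIso m m' f)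
    (h' : IsIso m' m'' g) : IsIso m m'' (g * f) := by
  constructor
  · intro e
    simp only [Equiv.Perm.mul_apply]
    rw [h.1, h'.1]
  · intro e
    simp only [Equiv.Perm.mul_apply]
    rw [h.2, h'.2]

theorem IsIso.next_eq {m m' : PlaneMap D} {f : Equiv.Perm D} (h : IsIso m m' f) :
    m'.next = f * m.next * f⁻¹ := by
  ext e
  simp [h.1]

theorem IsIso.sameCycle {m m' : PlaneMap D} {f : Equiv.Perm D} (h : IsIso m m' f) {a b : D} :
    m'.next.SameCycle (f a) (f b) ↔ m.next.SameCycle a b := by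
  rw [h.next_eq, Equiv.Perm.sameCycle_conj]
  simp

theorem IsIso.card_vertex {m m' : PlaneMap D} {f : Equiv.Perm D} (h : IsIso m m' f) :
    Nat.card m.Vertex = Nat.card m'.Vertex :=
  Nat.card_congr (Quotient.congr f fun _ _ => h.sameCycle.symm)

end PlaneMap

/-- Plane maps with `n` edges, with `2 * n` labelled oriented edges, and a distinguished
oriented edge, the root. -/
structure LabelledRootedMap (n : ℕ) extends PlaneMap (Fin (2 * n)) where
  root : Fin (2 * n)

/-- Labelled rooted plane maps with `n` edges and a distinguished vertex. -/
structure LabelledPointedMap (n : ℕ) extends LabelledRootedMap n where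
  point : toPlaneMap.Vertex

/-- Equality of rooted maps up to isomorphism preserving the root. -/
instance LabelledRootedMap.setoid (n : ℕ) : Setoid (LabelledRootedMap n) where
  r m m' := ∃ f, m.IsIso m'.toPlaneMap f ∧ f m.root = m'.root
  iseqv :=
    { refl := fun m => ⟨1, PlaneMap.IsIso.refl _, rfl⟩
      symm := fun ⟨f, hf, hr⟩ => ⟨f⁻¹, hf.symm, by rw [← hr]; simp⟩
      trans := fun ⟨f, hf, hr⟩ ⟨g, hg, hs⟩ => ⟨g * f, hf.trans hg, by
        rw [Equiv.Perm.mul_apply, hr, hs]⟩ }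

/-- Equality of rooted pointed maps up to isomorphism preserving the root and the distinguished
vertex. -/
instance LabelledPointedMap.setoid (n : ℕ) : Setoid (LabelledPointedMap n) where
  r m m' := ∃ f, m.IsIso m'.toPlaneMap f ∧ f m.root = m'.root ∧
    ∀ e, m.origin e = m.point ↔ m'.origin (f e) = m'.point
  iseqv :=
    { refl := fun m => ⟨1, PlaneMap.IsIso.refl _, rfl, fun _ => Iff.rfl⟩
      symm := fun ⟨f, hf, hr, hp⟩ => ⟨f⁻¹, hf.symm, by rw [← hr]; simp, fun e => by
        rw [hp]; simp⟩
      trans := fun ⟨f, hf, hr, hp⟩ ⟨g, hg, hs, hq⟩ => ⟨g * f, hf.trans hg, by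
        rw [Equiv.Perm.mul_apply, hr, hs], fun e => by
        rw [Equiv.Perm.mul_apply, hp, hq]⟩ }

/-- The set of rooted plane maps with `n` edges (`n ≥ 1`; there is no root when `n = 0`). -/
def RootedMap (n : ℕ) : Type := Quotient (LabelledRootedMap.setoid n)

/-- The set of rooted and pointed plane maps with `n` edges, `n ≥ 1`. -/
def PointedMap (n : ℕ) : Type := Quotient (LabelledPointedMap.setoid n)

/-- Forgetting the distinguished vertex. -/
def PointedMap.forget {n : ℕ} : PointedMap n → RootedMap n :=
  Quotient.map LabelledPointedMap.toLabelledRootedMap fun _ _ ⟨f, hf, hr, _⟩ => ⟨f, hf, hr⟩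

/-- The number of vertices of a rooted map. -/
noncomputable def RootedMap.numVertices {n : ℕ} : RootedMap n → ℕ :=
  Quotient.lift (fun m => Nat.card m.Vertex) fun _ _ ⟨_, hf, _⟩ => hf.card_vertex

instance (n : ℕ) : MeasurableSpace (RootedMap n) := ⊤

instance (n : ℕ) : MeasurableSpace (PointedMap n) := ⊤

/-- The law of a uniform rooted map with `n` edges. -/
noncomputable def rootedLaw (n : ℕ) : Measure (RootedMap n) :=
  uniformOn Set.univ

/-- The law of a uniform rooted pointed map with `n` edges whose distinguished vertex is
forgotten. -/
noncomputable def pointedLaw (n : ℕ) : Measure (RootedMap n) :=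
  (uniformOn (Set.univ : Set (PointedMap n))).map PointedMap.forget

instance (n : ℕ) : IsFiniteMeasure (rootedLaw n) := by
  unfold rootedLaw; infer_instance

instance (n : ℕ) : IsFiniteMeasure (pointedLaw n) := by
  unfold pointedLaw; infer_instance

/-- The total variation norm `|s|(X)` of a signed measure. -/
noncomputable def tvNorm {X : Type*} [MeasurableSpace X] (s : SignedMeasure X) : ℝ :=
  s.totalVariation.real Set.univ

/-! ### Numbers of classes of comparable equivalence relations. -/

section Quotients

variable {D : Type*}

/-! Everything reduces to two moments of the number V of vertices of a uniform rooted map with n ≥ 1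
edges: E V = (n+2)/2 and Var V ≤ (n+2)/4. The pointed law has density V / E V with respect to the
uniform law, so by Cauchy–Schwarz the norm of the difference is at most √(Var V) / E V ≤
(n+2)^(-1/2). Moreover E(2V/n − 1)² = 4 (Var V + 1)/n² ≤ (n+6)/n².

The moments come from Tutte's recursion. The root is replaced by a leg, a half-edge fixed by the
involution, inserted just after it around its origin (`bijOn_insertAfter`). Deleting the edge that
follows the leg leaves either one planar map, in which the ends of the deleted edge lay in a common
face, or two planar maps (`isPlanar_matchNone`). This is a count of cycles under multiplication by
transpositions, together with Euler's inequality `numCycles_add_le`. Let u be the weight of a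
vertex, x the weight of a unit of length of the root face, and let t mark the edges. After division
by (2n)!, the number of labellings of a rooted map, `stdMapSum_add_two` becomes (x−1) F(x) = u x
(x−1) + t (x² (F(x) − F(1)) + (x−1) x F(x)²).

Expand at u = 1 to second order. The coefficients F, G, H of 1, u−1, (u−1)² have values f, g, h at x
= 1, which are the generating functions of the sums of 1, V and V(V−1)/2. The equation for F is
solved by the quadratic method; those for G and H are linear with the same kernel. With q = t g,
`kernel_method` yields g (1−3q) = 1, f = g² (1−4q) and h (1−2q)(1−6q) = q. Hence `coeff_relations`:
2 g_n = (n+2) f_n, which is the mean, and 4 h_n ≤ (n+1) g_n, which bounds the variance. -/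

theorem card_quotient_le_of_le [Finite D] {s s' : Setoid D} (h : ∀ x y, s x y → s' x y) :
    Nat.card (Quotient s') ≤ Nat.card (Quotient s) := by
  refine Nat.card_le_card_of_surjective
    (Quotient.map' (s₁ := s) (s₂ := s') id fun x y hxy => h x y hxy) ?_
  rintro ⟨x⟩
  exact ⟨Quotient.mk s x, rfl⟩

theorem card_quotient_lt_of_le [Finite D] {s s' : Setoid D} (h : ∀ x y, s x y → s' x y)
    {a b : D} (hab : s' a b) (hab' : ¬ s a b) :
    Nat.card (Quotient s') < Nat.card (Quotient s) := by
  classical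
  have := Fintype.ofFinite D
  have := Fintype.ofFinite (Quotient s)
  have := Fintype.ofFinite (Quotient s')
  rw [Nat.card_eq_fintype_card, Nat.card_eq_fintype_card]
  refine Fintype.card_lt_of_surjective_not_injective
    (Quotient.map' (s₁ := s) (s₂ := s') id fun x y hxy => h x y hxy) ?_ ?_
  · rintro ⟨x⟩
    exact ⟨Quotient.mk s x, rfl⟩
  · intro hinj
    exact hab' (Quotient.exact (hinj (a₁ := Quotient.mk s a) (a₂ := Quotient.mk s b)
      (Quotient.sound (s := s') hab)))

/-- Merging two classes of an equivalence relation decreases the number of classes by at most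
one. -/
theorem card_quotient_le_succ [Finite D] {s s' : Setoid D} (a b : D)
    (h : ∀ x y, s' x y → s x y ∨ (s x a ∧ s b y) ∨ (s x b ∧ s a y)) :
    Nat.card (Quotient s) ≤ Nat.card (Quotient s') + 1 := by
  classical
  rw [← Finite.card_option]
  -- The class of `a` goes to `none`, which is the one lost class; on the other classes, passing to
  -- `s'` is injective.
  refine Nat.card_le_card_of_injective
    (fun c : Quotient s => if s c.out a then none else some (Quotient.mk s' c.out)) ?_
  intro c d hcd
  rw [← c.out_eq, ← d.out_eq]
  refine Quotient.sound (s := s) ?_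
  dsimp only at hcd
  split_ifs at hcd with hc hd hd
  · exact s.trans hc (s.symm hd)
  · rcases h _ _ (Quotient.exact (Option.some_injective _ hcd)) with h | ⟨h, -⟩ | ⟨-, h⟩
    · exact h
    · exact absurd h hc
    · exact absurd (s.symm h) hd

end Quotients

/-! ### Cycles of a permutation under multiplication by a transposition and under sums. -/

section CycleCount

variable {D : Type*}

/-- The number of cycles of a permutation, fixed points included. -/
noncomputable def numCycles (σ : Equiv.Perm D) : ℕ := Nat.card (Cycles σ)

open Equiv Equiv.Perm

theorem sameCycle_closed [Finite D] {σ : Perm D} {p : Set D} (hp : ∀ z ∈ p, σ z ∈ p) {x y : D}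
    (h : σ.SameCycle x y) (hx : x ∈ p) : y ∈ p := by
  obtain ⟨i, rfl⟩ := h.exists_nat_pow_eq
  induction i with
  | zero => simpa using hx
  | succ i ih =>
    rw [pow_succ', mul_apply]
    exact hp _ (ih ⟨i, by simp⟩)

theorem sameCycle_apply_self (σ : Perm D) (x : D) : σ.SameCycle x (σ x) := ⟨1, by simp⟩

/-- A step of `swap a b * σ` is a step of `σ`, except that arrivals at `a` and at `b` are exchanged.
-/
theorem sameCycle_swap_mul [Finite D] [DecidableEq D] {σ : Perm D} {a b x y : D}
    (h : (swap a b * σ).SameCycle x y) :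
    σ.SameCycle x y ∨ (σ.SameCycle x a ∧ σ.SameCycle b y) ∨
      (σ.SameCycle x b ∧ σ.SameCycle a y) := by
  refine sameCycle_closed (p := {y | σ.SameCycle x y ∨ (σ.SameCycle x a ∧ σ.SameCycle b y) ∨
      (σ.SameCycle x b ∧ σ.SameCycle a y)}) ?_ h (Or.inl (SameCycle.refl _ _))
  intro z hz
  have hz' : σ.SameCycle x (σ z) ∨ (σ.SameCycle x a ∧ σ.SameCycle b (σ z)) ∨
      (σ.SameCycle x b ∧ σ.SameCycle a (σ z)) := by
    simpa only [sameCycle_apply_right] using Set.mem_ofPred.1 hz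
  rw [mul_apply]
  change σ.SameCycle x _ ∨ (σ.SameCycle x a ∧ σ.SameCycle b _) ∨
      (σ.SameCycle x b ∧ σ.SameCycle a _)
  generalize σ z = w at hz'
  rcases eq_or_ne w a with rfl | ha
  · rw [swap_apply_left]
    rcases hz' with h | ⟨h, h'⟩ | ⟨h, h'⟩
    · exact Or.inr (Or.inl ⟨h, SameCycle.refl _ _⟩)
    · exact Or.inr (Or.inl ⟨h, SameCycle.refl _ _⟩)
    · exact Or.inl h
  · rcases eq_or_ne w b with rfl | hb
    · rw [swap_apply_right]
      rcases hz' with h | ⟨h, h'⟩ | ⟨h, h'⟩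
      · exact Or.inr (Or.inr ⟨h, SameCycle.refl _ _⟩)
      · exact Or.inl h
      · exact Or.inr (Or.inr ⟨h, SameCycle.refl _ _⟩)
    · rwa [swap_apply_of_ne_of_ne ha hb]

theorem numCycles_le_swap_mul [Finite D] [DecidableEq D] (σ : Perm D) (a b : D) :
    numCycles σ ≤ numCycles (swap a b * σ) + 1 :=
  card_quotient_le_succ (s := SameCycle.setoid σ) (s' := SameCycle.setoid (swap a b * σ)) a b
    fun _ _ => sameCycle_swap_mul

theorem numCycles_swap_mul_le [Finite D] [DecidableEq D] (σ : Perm D) (a b : D) :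
    numCycles (swap a b * σ) ≤ numCycles σ + 1 := by
  simpa [← mul_assoc] using numCycles_le_swap_mul (swap a b * σ) a b

/-- The `σ`-cycle of `a` avoids `b`, so the new permutation follows it up to the step that would
return to `a`, and this step now lands on `b`. -/
theorem SameCycle.of_swap_mul [Finite D] [DecidableEq D] {σ : Perm D} {a b : D}
    (h : ¬ σ.SameCycle a b) : (swap a b * σ).SameCycle a b := by
  by_contra hab
  have key : ∀ i : ℕ, (swap a b * σ).SameCycle a ((σ ^ i) a) := by
    intro i
    induction i with
    | zero => exact SameCycle.refl _ _
    | succ i ih =>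
      rw [pow_succ', mul_apply]
      have h1 := ih.trans (sameCycle_apply_self (swap a b * σ) _)
      rw [mul_apply] at h1
      rcases eq_or_ne (σ ((σ ^ i) a)) a with ha | ha
      · rw [ha]
      · rcases eq_or_ne (σ ((σ ^ i) a)) b with hb | hb
        · exact absurd ⟨(i + 1 : ℕ), by rw [zpow_natCast, pow_succ', mul_apply, hb]⟩ h
        · rwa [swap_apply_of_ne_of_ne ha hb] at h1
  obtain ⟨i, hi⟩ := (show σ.SameCycle a (σ⁻¹ a) from ⟨-1, by simp⟩).exists_nat_pow_eq
  have h1 := (key i).trans (sameCycle_apply_self (swap a b * σ) _)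
  rw [hi, mul_apply] at h1
  simp [hab] at h1

theorem SameCycle.swap_mul_of_not [Finite D] [DecidableEq D] {σ : Perm D} {a b x y : D}
    (h : ¬ σ.SameCycle a b) (hxy : σ.SameCycle x y) : (swap a b * σ).SameCycle x y := by
  refine sameCycle_closed (p := {y | (swap a b * σ).SameCycle x y}) ?_ hxy (SameCycle.refl _ _)
  intro z hz
  have h1 := SameCycle.trans hz (sameCycle_apply_self (swap a b * σ) z)
  have hab := SameCycle.of_swap_mul h
  rw [mul_apply] at h1
  change (swap a b * σ).SameCycle x _
  rcases eq_or_ne (σ z) a with ha | ha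
  · rw [ha, swap_apply_left] at h1
    rw [ha]
    exact h1.trans hab.symm
  · rcases eq_or_ne (σ z) b with hb | hb
    · rw [hb, swap_apply_right] at h1
      rw [hb]
      exact h1.trans hab
    · rwa [swap_apply_of_ne_of_ne ha hb] at h1

theorem numCycles_swap_mul_of_not [Finite D] [DecidableEq D] {σ : Perm D} {a b : D}
    (h : ¬ σ.SameCycle a b) : numCycles (swap a b * σ) + 1 = numCycles σ := by
  refine le_antisymm ?_ (numCycles_le_swap_mul σ a b)
  exact card_quotient_lt_of_le (s := SameCycle.setoid σ) (s' := SameCycle.setoid (swap a b * σ))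
    (fun _ _ => SameCycle.swap_mul_of_not h) (SameCycle.of_swap_mul h) h

/-- The arc from `a` to just before the first visit to `b` is closed under the new permutation: the
step that would reach `b` is sent back to `a`. -/
theorem not_sameCycle_swap_mul [Finite D] [DecidableEq D] {σ : Perm D} {a b : D} (hab : a ≠ b)
    (h : σ.SameCycle a b) : ¬ (swap a b * σ).SameCycle a b := by
  classical
  have hex := h.exists_nat_pow_eq
  set k := Nat.find hex with hk
  have hkb : (σ ^ k) a = b := Nat.find_spec hex
  have hmin : ∀ i < k, (σ ^ i) a ≠ b := fun i hi => Nat.find_min hex hi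
  intro h'
  have hb : b ∈ {y | ∃ i < k, (σ ^ i) a = y} := by
    refine sameCycle_closed ?_ h' ⟨0, ?_, rfl⟩
    · rintro z ⟨i, hi, rfl⟩
      rw [mul_apply, ← mul_apply σ, ← pow_succ']
      have hk0 : 0 < k := by omega
      rcases eq_or_ne ((σ ^ (i + 1)) a) a with ha | ha
      · exfalso
        have : (σ ^ (k - (i + 1))) a = b := by
          rw [← hkb, ← Nat.sub_add_cancel (show i + 1 ≤ k from hi), pow_add, mul_apply, ha]
          simp
        exact hmin _ (by omega) this
      · rcases eq_or_ne ((σ ^ (i + 1)) a) b with hb | hb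
        · exact ⟨0, hk0, by rw [hb, swap_apply_right]; rfl⟩
        · refine ⟨i + 1, ?_, by rw [swap_apply_of_ne_of_ne ha hb]⟩
          rcases Nat.lt_or_ge (i + 1) k with h | h
          · exact h
          · exact absurd (by rw [← hkb, show k = i + 1 by omega]) hb
    · rcases Nat.eq_zero_or_pos k with h0 | h0
      · exact absurd (by simpa [h0] using hkb) hab
      · exact h0
  obtain ⟨i, hi, h⟩ := hb
  exact hmin i hi h

theorem numCycles_swap_mul_of_sameCycle [Finite D] [DecidableEq D] {σ : Perm D} {a b : D}
    (hab : a ≠ b) (h : σ.SameCycle a b) : numCycles (swap a b * σ) = numCycles σ + 1 := by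
  have := numCycles_swap_mul_of_not (not_sameCycle_swap_mul hab h)
  rw [← mul_assoc, swap_mul_self, one_mul] at this
  exact this.symm

theorem numCycles_inv (σ : Perm D) : numCycles σ⁻¹ = numCycles σ :=
  Nat.card_congr (Quotient.congr (Equiv.refl D) fun _ _ => sameCycle_inv)

theorem numCycles_congr {D' : Type*} (e : D ≃ D') {σ : Perm D} {σ' : Perm D'}
    (h : ∀ x y, σ.SameCycle x y ↔ σ'.SameCycle (e x) (e y)) : numCycles σ = numCycles σ' :=
  Nat.card_congr (Quotient.congr e h)

theorem sameCycle_permCongr {D' : Type*} (e : D ≃ D') (σ : Perm D) (x y : D) :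
    (e.permCongr σ).SameCycle (e x) (e y) ↔ σ.SameCycle x y := by
  have h : ∀ i : ℤ, (e.permCongr σ ^ i) (e x) = e ((σ ^ i) x) := by
    intro i
    have := map_zpow e.permCongrHom σ i
    have h2 : e.permCongr σ ^ i = e.permCongr (σ ^ i) := this.symm
    rw [h2]
    simp
  simp [SameCycle, h]

theorem numCycles_permCongr {D' : Type*} (e : D ≃ D') (σ : Perm D) :
    numCycles (e.permCongr σ) = numCycles σ :=
  (numCycles_congr e fun x y => (sameCycle_permCongr e σ x y).symm).symm

theorem numCycles_mul_comm (σ τ : Perm D) : numCycles (σ * τ) = numCycles (τ * σ) := by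
  have : σ * τ = σ.permCongr (τ * σ) := by ext x; simp
  rw [this, numCycles_permCongr]

theorem numCycles_mul_swap_of_not [Finite D] [DecidableEq D] {σ : Perm D} {a b : D}
    (h : ¬ σ.SameCycle a b) : numCycles (σ * swap a b) + 1 = numCycles σ := by
  rw [numCycles_mul_comm, numCycles_swap_mul_of_not h]

theorem numCycles_one : numCycles (1 : Perm D) = Nat.card D := by
  refine Nat.card_congr ⟨Quotient.lift id ?_, Quotient.mk _, ?_, fun _ => rfl⟩
  · intro a b h
    exact (sameCycle_one.1 h)
  · rintro ⟨x⟩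
    rfl

theorem sameCycle_optionCongr (σ : Perm D) (x y : D) :
    SameCycle (optionCongr σ) (some x) (some y) ↔ σ.SameCycle x y := by
  have h1 : ∀ i : ℕ, ∀ σ : Perm D, (optionCongr σ ^ i) (some x) = some ((σ ^ i) x) := by
    intro i σ
    induction i with
    | zero => rfl
    | succ i ih => simp [pow_succ', mul_apply, ih]
  have h : ∀ i : ℤ, (optionCongr σ ^ i) (some x) = some ((σ ^ i) x) := by
    intro i
    rcases Int.eq_nat_or_neg i with ⟨n, rfl | rfl⟩
    · simpa using h1 n σ
    · have h2 : (optionCongr σ)⁻¹ = optionCongr σ⁻¹ := optionCongr_symm σ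
      rw [zpow_neg, zpow_neg, ← inv_zpow, ← inv_zpow, h2]
      simpa using h1 n σ⁻¹
  simp [SameCycle, h]

theorem not_sameCycle_optionCongr [Finite D] (σ : Perm D) (x : D) :
    ¬ SameCycle (optionCongr σ) none (some x) := by
  intro h
  have : some x ∈ ({none} : Set (Option D)) :=
    sameCycle_closed (by rintro z rfl; simp) h rfl
  simp at this

theorem numCycles_optionCongr [Finite D] (σ : Perm D) :
    numCycles (optionCongr σ) = numCycles σ + 1 := by
  rw [numCycles, numCycles, ← Finite.card_option]
  let f : Option (Cycles σ) → Cycles (optionCongr σ : Perm (Option D))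
    | none => Quotient.mk _ none
    | some c => Quotient.map' (s₁ := SameCycle.setoid σ) (s₂ := SameCycle.setoid (optionCongr σ))
        some (fun x y h => (sameCycle_optionCongr σ x y).2 h) c
  refine (Nat.card_congr (Equiv.ofBijective f ⟨?_, ?_⟩)).symm
  · rintro (_ | c) (_ | d) h
    · rfl
    · obtain ⟨y, rfl⟩ := Quotient.exists_rep d
      exact absurd (Quotient.exact h) (not_sameCycle_optionCongr σ y)
    · obtain ⟨x, rfl⟩ := Quotient.exists_rep c
      exact absurd (Quotient.exact h.symm) (not_sameCycle_optionCongr σ x)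
    · obtain ⟨x, rfl⟩ := Quotient.exists_rep c
      obtain ⟨y, rfl⟩ := Quotient.exists_rep d
      exact congrArg some (Quotient.sound ((sameCycle_optionCongr σ x y).1 (Quotient.exact h)))
  · rintro ⟨_ | x⟩
    · exact ⟨none, rfl⟩
    · exact ⟨some (Quotient.mk _ x), rfl⟩

theorem sameCycle_sumCongr_inl {A B : Type*} (f : Perm A) (g : Perm B) (x y : A) :
    (Perm.sumCongr f g).SameCycle (Sum.inl x) (Sum.inl y) ↔ f.SameCycle x y := by
  have h : ∀ i : ℤ, (Perm.sumCongr f g ^ i) (Sum.inl x) = Sum.inl ((f ^ i) x) := by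
    intro i
    have := map_zpow (sumCongrHom A B) (f, g) i
    have h2 : Perm.sumCongr f g ^ i = Perm.sumCongr (f ^ i) (g ^ i) := this.symm
    rw [h2]
    simp
  simp [SameCycle, h]

theorem sameCycle_sumCongr_inr {A B : Type*} (f : Perm A) (g : Perm B) (x y : B) :
    (Perm.sumCongr f g).SameCycle (Sum.inr x) (Sum.inr y) ↔ g.SameCycle x y := by
  have h : ∀ i : ℤ, (Perm.sumCongr f g ^ i) (Sum.inr x) = Sum.inr ((g ^ i) x) := by
    intro i
    have := map_zpow (sumCongrHom A B) (f, g) i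
    have h2 : Perm.sumCongr f g ^ i = Perm.sumCongr (f ^ i) (g ^ i) := this.symm
    rw [h2]
    simp
  simp [SameCycle, h]

theorem not_sameCycle_sumCongr {A B : Type*} [Finite A] [Finite B] (f : Perm A) (g : Perm B)
    (x : A) (y : B) : ¬ (Perm.sumCongr f g).SameCycle (Sum.inl x) (Sum.inr y) := by
  intro h
  have : Sum.inr y ∈ Set.range (Sum.inl : A → A ⊕ B) :=
    sameCycle_closed (by rintro z ⟨x, rfl⟩; exact ⟨f x, by simp⟩) h ⟨x, rfl⟩
  simp at this

theorem numCycles_sumCongr {A B : Type*} [Finite A] [Finite B] (f : Perm A) (g : Perm B) :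
    numCycles (Perm.sumCongr f g) = numCycles f + numCycles g := by
  rw [numCycles, numCycles, numCycles, ← Nat.card_sum]
  let F : Cycles f ⊕ Cycles g → Cycles (Perm.sumCongr f g)
    | Sum.inl c => Quotient.map' (s₁ := SameCycle.setoid f)
        (s₂ := SameCycle.setoid (Perm.sumCongr f g))
        Sum.inl (fun x y h => (sameCycle_sumCongr_inl f g x y).2 h) c
    | Sum.inr c => Quotient.map' (s₁ := SameCycle.setoid g)
        (s₂ := SameCycle.setoid (Perm.sumCongr f g))
        Sum.inr (fun x y h => (sameCycle_sumCongr_inr f g x y).2 h) c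
  refine (Nat.card_congr (Equiv.ofBijective F ⟨?_, ?_⟩)).symm
  · rintro (c | c) (d | d) h <;> obtain ⟨x, rfl⟩ := Quotient.exists_rep c <;>
      obtain ⟨y, rfl⟩ := Quotient.exists_rep d
    · exact congrArg Sum.inl
        (Quotient.sound ((sameCycle_sumCongr_inl f g x y).1 (Quotient.exact h)))
    · exact absurd (Quotient.exact h) (not_sameCycle_sumCongr f g x y)
    · exact absurd (Quotient.exact h.symm) (not_sameCycle_sumCongr f g y x)
    · exact congrArg Sum.inr
        (Quotient.sound ((sameCycle_sumCongr_inr f g x y).1 (Quotient.exact h)))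
  · rintro ⟨x | x⟩
    · exact ⟨Sum.inl (Quotient.mk _ x), rfl⟩
    · exact ⟨Sum.inr (Quotient.mk _ x), rfl⟩

end CycleCount

/-! ### Components, genus and Euler's inequality. -/

section Components

open Equiv Equiv.Perm

variable {D : Type*}

/-- Stability of a set under two permutations. -/
def Stable (σ α : Perm D) (p : Set D) : Prop :=
  (∀ z, σ z ∈ p ↔ z ∈ p) ∧ ∀ z, α z ∈ p ↔ z ∈ p

/-- The partition into the orbits of the group generated by two permutations. -/
def compSetoid (σ α : Perm D) : Setoid D where
  r x y := ∀ p, Stable σ α p → (x ∈ p ↔ y ∈ p)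
  iseqv := ⟨fun _ _ _ => Iff.rfl, fun h _ hp => (h _ hp).symm,
    fun h h' p hp => (h p hp).trans (h' p hp)⟩

/-- The number of orbits of the group generated by two permutations. -/
noncomputable def numComps (σ α : Perm D) : ℕ := Nat.card (Quotient (compSetoid σ α))

/-- The group generated by two permutations has at most one orbit. -/
def JointlyTransitive (σ α : Perm D) : Prop := ∀ x y, compSetoid σ α x y

/-- The two permutations define a connected hypermap of genus zero. -/
def IsPlanar (σ α : Perm D) : Prop :=
  JointlyTransitive σ α ∧ numCycles σ + numCycles α + numCycles (σ⁻¹ * α) = Nat.card D + 2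

theorem Stable.inv_left {σ α : Perm D} {p : Set D} (h : Stable σ α p) (z : D) :
    σ⁻¹ z ∈ p ↔ z ∈ p := by
  rw [← h.1, ← mul_apply, mul_inv_cancel, one_apply]

theorem Stable.inv_mul {σ α : Perm D} {p : Set D} (h : Stable σ α p) (z : D) :
    (σ⁻¹ * α) z ∈ p ↔ z ∈ p := by
  rw [mul_apply, h.inv_left, h.2]

theorem compSetoid_stable (σ α : Perm D) (x : D) : Stable σ α {y | compSetoid σ α x y} :=
  ⟨fun _ => forall₂_congr fun _ hp => by rw [hp.1],
    fun _ => forall₂_congr fun _ hp => by rw [hp.2]⟩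

theorem compSetoid_of_sameCycle_inv_mul [Finite D] {σ α : Perm D} {x y : D}
    (h : (σ⁻¹ * α).SameCycle x y) : compSetoid σ α x y := fun _ hp =>
  ⟨fun hx => sameCycle_closed (fun z hz => (hp.inv_mul z).2 hz) h hx,
    fun hy => sameCycle_closed (fun z hz => (hp.inv_mul z).2 hz) h.symm hy⟩

theorem numComps_one [Finite D] (σ : Perm D) : numComps σ 1 = numCycles σ := by
  refine Nat.card_congr (Quotient.congr (Equiv.refl D) fun x y => ⟨fun h => ?_, fun h p hp => ?_⟩)
  · exact (h {y | σ.SameCycle x y} ⟨fun z => sameCycle_apply_right, fun z => Iff.rfl⟩).1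
      (SameCycle.refl _ _)
  · exact ⟨fun hx => sameCycle_closed (fun z hz => (hp.1 z).2 hz) h hx,
      fun hx => sameCycle_closed (fun z hz => (hp.1 z).2 hz) h.symm hx⟩

theorem Stable.swap_mul [DecidableEq D] {σ α : Perm D} {p : Set D} {a b : D}
    (h : Stable σ α p) (hab : a ∈ p ↔ b ∈ p) : Stable σ (swap a b * α) p := by
  refine ⟨h.1, fun z => ?_⟩
  rw [mul_apply, ← h.2 z]
  generalize α z = w
  rcases eq_or_ne w a with rfl | ha
  · rw [swap_apply_left, hab]
  · rcases eq_or_ne w b with rfl | hb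
    · rw [swap_apply_right, hab]
    · rw [swap_apply_of_ne_of_ne ha hb]

/-- The union of the components of `a` and `b` stays stable when `α` becomes `swap a b * α`, and so
does every other component; hence at most these two are merged. -/
theorem numComps_swap_mul_le [Finite D] [DecidableEq D] (σ α : Perm D) (a b : D) :
    numComps σ α ≤ numComps σ (swap a b * α) + 1 := by
  refine card_quotient_le_succ (s := compSetoid σ α) (s' := compSetoid σ (swap a b * α)) a b
    fun x y h => ?_
  have hs := compSetoid_stable σ α
  by_cases hxa : compSetoid σ α x a
  · by_cases hxb : compSetoid σ α x b
    · exact Or.inl ((h _ ((hs x).swap_mul ⟨fun _ => hxb, fun _ => hxa⟩)).1 ((compSetoid σ α).refl _))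
    · have hst : Stable σ α {y | compSetoid σ α x y ∨ compSetoid σ α b y} :=
        ⟨fun z => or_congr ((hs x).1 z) ((hs b).1 z), fun z => or_congr ((hs x).2 z) ((hs b).2 z)⟩
      rcases (h _ (hst.swap_mul ⟨fun _ => Or.inr ((compSetoid σ α).refl _), fun _ => Or.inl hxa⟩)).1
        (Or.inl ((compSetoid σ α).refl _)) with h1 | h1
      · exact Or.inl h1
      · exact Or.inr (Or.inl ⟨hxa, h1⟩)
  · by_cases hxb : compSetoid σ α x b
    · have hst : Stable σ α {y | compSetoid σ α x y ∨ compSetoid σ α a y} :=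
        ⟨fun z => or_congr ((hs x).1 z) ((hs a).1 z), fun z => or_congr ((hs x).2 z) ((hs a).2 z)⟩
      rcases (h _ (hst.swap_mul ⟨fun _ => Or.inl hxb, fun _ => Or.inr ((compSetoid σ α).refl _)⟩)).1
        (Or.inl ((compSetoid σ α).refl _)) with h1 | h1
      · exact Or.inl h1
      · exact Or.inr (Or.inr ⟨hxb, h1⟩)
    · exact Or.inl ((h _ ((hs x).swap_mul ⟨fun h => absurd h hxa, fun h => absurd h hxb⟩)).1
        ((compSetoid σ α).refl _))

/-- Euler's inequality: the genus is nonnegative. -/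
theorem numCycles_add_le [Finite D] (σ α : Perm D) :
    numCycles σ + numCycles α + numCycles (σ⁻¹ * α) ≤ Nat.card D + 2 * numComps σ α := by
  classical
  have := Fintype.ofFinite D
  induction hn : α.support.card using Nat.strong_induction_on generalizing α with
  | _ n ih =>
    subst hn
    by_cases hα : α = 1
    · subst hα
      rw [mul_one, numCycles_inv, numComps_one, numCycles_one]
      omega
    · obtain ⟨a, ha⟩ : ∃ a, α a ≠ a := by
        by_contra! h
        exact hα (Equiv.ext h)
      have h1 := ih _ (card_support_swap_mul ha) _ rfl
      have h2 := numCycles_swap_mul_of_sameCycle ha.symm (sameCycle_apply_self α a)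
      generalize α a = b at *
      -- The induction is on the support of `α`: composing with the transposition detaches `a` from
      -- its cycle, so `β` has one cycle more than `α` and a smaller support.
      set β := swap a b * α with hβ
      have hαβ : α = swap a b * β := by rw [hβ, ← mul_assoc, swap_mul_self, one_mul]
      have h3 : numCycles (σ⁻¹ * α) = numCycles (swap a b * (β * σ⁻¹)) := by
        rw [numCycles_mul_comm, hαβ, mul_assoc]
      have h4 : numCycles (σ⁻¹ * β) = numCycles (β * σ⁻¹) := numCycles_mul_comm _ _
      have h5 := numComps_swap_mul_le σ β a b
      rw [← hαβ] at h5
      -- If `a` and `b` are already connected under `β`, then `α` has no fewer components and at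
      -- most one face more, which the lost cycle pays for. Otherwise two faces are joined, and
      -- losing one cycle and one face compensates the possible loss of a component, counted twice.
      by_cases hab : compSetoid σ β a b
      · have h6 := numCycles_swap_mul_le (β * σ⁻¹) a b
        have h7 : numComps σ β ≤ numComps σ α := by
          refine card_quotient_le_of_le (s := compSetoid σ α) (s' := compSetoid σ β)
            fun x y hxy p hp => hxy p ?_
          rw [hαβ]
          exact hp.swap_mul (hab p hp)
        omega
      · have h6 : ¬ (β * σ⁻¹).SameCycle a b := by
          intro h
          refine hab fun p hp => ?_
          have hst : ∀ z ∈ p, (β * σ⁻¹) z ∈ p := fun z hz => by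
            rwa [mul_apply, hp.2, hp.inv_left]
          exact ⟨fun h' => sameCycle_closed hst h h', fun h' => sameCycle_closed hst h.symm h'⟩
        have h7 := numCycles_swap_mul_of_not h6
        omega

theorem JointlyTransitive.numCycles_add_le [Finite D] {σ α : Perm D}
    (h : JointlyTransitive σ α) :
    numCycles σ + numCycles α + numCycles (σ⁻¹ * α) ≤ Nat.card D + 2 := by
  have h1 := _root_.numCycles_add_le σ α
  have h2 : numComps σ α ≤ 1 := by
    rw [numComps, Finite.card_le_one_iff_subsingleton]
    refine ⟨?_⟩
    rintro ⟨x⟩ ⟨y⟩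
    exact Quotient.sound (s := compSetoid σ α) (h x y)
  omega

theorem JointlyTransitive.permCongr {D' : Type*} (e : D ≃ D') {σ α : Perm D}
    (h : JointlyTransitive σ α) : JointlyTransitive (e.permCongr σ) (e.permCongr α) := by
  intro x y p hp
  have := h (e.symm x) (e.symm y) (e ⁻¹' p)
    ⟨fun z => by simpa using hp.1 (e z), fun z => by simpa using hp.2 (e z)⟩
  simpa using this

theorem IsPlanar.permCongr {D' : Type*} (e : D ≃ D') {σ α : Perm D}
    (h : IsPlanar σ α) : IsPlanar (e.permCongr σ) (e.permCongr α) := by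
  refine ⟨h.1.permCongr e, ?_⟩
  have h1 : (e.permCongr σ)⁻¹ * e.permCongr α = e.permCongr (σ⁻¹ * α) := by
    rw [show (e.permCongr σ)⁻¹ = e.permCongr σ⁻¹ from rfl]
    ext x
    simp
  rw [h1, numCycles_permCongr, numCycles_permCongr, numCycles_permCongr, h.2, Nat.card_congr e]

end Components

/-! ### Insertion of a leg and of an edge; deletion of the root edge. -/

section Insertion

open Equiv Equiv.Perm

variable {D : Type*}

theorem optionCongr_mul (σ τ : Perm D) :
    (optionCongr (σ * τ) : Perm (Option D)) = optionCongr σ * optionCongr τ := by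
  ext1 x
  cases x <;> rfl

/-- The set of `Option D` obtained from a set of `D` by adding `none` when it contains `c`. -/
def extendSet (p : Set D) (c : D) : Set (Option D) := {z | z.elim (c ∈ p) (· ∈ p)}

@[simp] theorem some_mem_extendSet {p : Set D} {c x : D} : some x ∈ extendSet p c ↔ x ∈ p := Iff.rfl

@[simp] theorem none_mem_extendSet {p : Set D} {c : D} : none ∈ extendSet p c ↔ c ∈ p := Iff.rfl

/-- The permutation of `Option D` in which `none` is inserted after `c` in its cycle. -/
def insertAfter [DecidableEq D] (σ : Perm D) (c : D) : Perm (Option D) :=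
  optionCongr σ * swap (some c) none

section

variable [DecidableEq D]

@[simp] theorem insertAfter_none (σ : Perm D) (c : D) : insertAfter σ c none = some (σ c) := by
  simp [insertAfter]

@[simp] theorem insertAfter_self (σ : Perm D) (c : D) : insertAfter σ c (some c) = none := by
  simp [insertAfter]

theorem insertAfter_some (σ : Perm D) {c x : D} (h : x ≠ c) :
    insertAfter σ c (some x) = some (σ x) := by
  simp [insertAfter, swap_apply_of_ne_of_ne, h]

theorem insertAfter_inv (σ : Perm D) (c : D) :
    (insertAfter σ c)⁻¹ = swap (some c) none * optionCongr σ⁻¹ := by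
  rw [insertAfter, mul_inv_rev, swap_inv]
  rfl

theorem numCycles_insertAfter [Finite D] (σ : Perm D) (c : D) :
    numCycles (insertAfter σ c) = numCycles σ := by
  have := numCycles_mul_swap_of_not (σ := optionCongr σ) (a := some c) (b := none)
    fun h => not_sameCycle_optionCongr σ c h.symm
  rw [numCycles_optionCongr] at this
  exact Nat.succ_injective this

theorem insertAfter_mem_extendSet {σ : Perm D} {p : Set D} (h : ∀ z, σ z ∈ p ↔ z ∈ p) (c : D)
    (z : Option D) : insertAfter σ c z ∈ extendSet p c ↔ z ∈ extendSet p c := by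
  cases z with
  | none => simp [h]
  | some x =>
    rcases eq_or_ne x c with rfl | hx
    · simp
    · simp [insertAfter_some, hx, h]

theorem mem_preimage_some_of_insertAfter {σ : Perm D} {c : D} {p : Set (Option D)}
    (h : ∀ z, insertAfter σ c z ∈ p ↔ z ∈ p) :
    (none ∈ p ↔ some c ∈ p) ∧ ∀ z, some (σ z) ∈ p ↔ some z ∈ p := by
  have hc : none ∈ p ↔ some c ∈ p := by simpa using h (some c)
  refine ⟨hc, fun z => ?_⟩
  rcases eq_or_ne z c with rfl | hz
  · rw [← hc]
    simpa using h none
  · simpa [insertAfter_some, hz] using h (some z)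

theorem jointlyTransitive_insertAfter {σ α : Perm D} {c : D} :
    JointlyTransitive (insertAfter σ c) (optionCongr α) ↔ JointlyTransitive σ α := by
  constructor
  · intro h x y p hp
    refine h (some x) (some y) (extendSet p c) ⟨insertAfter_mem_extendSet hp.1 c, fun z => ?_⟩
    cases z <;> simp [hp.2]
  · intro h x y p hp
    obtain ⟨hc, hσ⟩ := mem_preimage_some_of_insertAfter hp.1
    have hst : Stable σ α (some ⁻¹' p) := ⟨hσ, fun z => by simpa using hp.2 (some z)⟩
    have key : ∀ x, x ∈ p ↔ some c ∈ p := by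
      rintro (_ | x)
      · exact hc
      · exact h x c _ hst
    rw [key x, key y]

/-- The new leg adds one element and one cycle of the second permutation, and the new fixed point of
the face permutation is absorbed by an existing face; Euler's relation is unaffected. -/
theorem isPlanar_insertAfter [Finite D] {σ α : Perm D} {c : D} :
    IsPlanar (insertAfter σ c) (optionCongr α) ↔ IsPlanar σ α := by
  have h1 : (insertAfter σ c)⁻¹ * optionCongr α = swap (some c) none * optionCongr (σ⁻¹ * α) := by
    rw [insertAfter_inv, mul_assoc, ← optionCongr_mul]
  have h2 := numCycles_swap_mul_of_not (σ := optionCongr (σ⁻¹ * α)) (a := some c) (b := none)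
    fun h => not_sameCycle_optionCongr _ c h.symm
  rw [← h1, numCycles_optionCongr] at h2
  rw [IsPlanar, IsPlanar, jointlyTransitive_insertAfter, numCycles_insertAfter,
    numCycles_optionCongr, Finite.card_option]
  refine and_congr_right fun _ => ?_
  omega

/-- The involution of `Option D` in which `none` is matched with the fixed point `b`. -/
def matchNone (α : Perm D) (b : D) : Perm (Option D) := optionCongr α * swap none (some b)

@[simp] theorem matchNone_none (α : Perm D) (b : D) : matchNone α b none = some (α b) := by
  simp [matchNone]

@[simp] theorem matchNone_self (α : Perm D) (b : D) : matchNone α b (some b) = none := by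
  simp [matchNone]

theorem matchNone_some (α : Perm D) {b x : D} (h : x ≠ b) :
    matchNone α b (some x) = some (α x) := by
  simp [matchNone, swap_apply_of_ne_of_ne, h]

theorem matchNone_eq (α : Perm D) (b : D) : matchNone α b = insertAfter α b := by
  rw [matchNone, insertAfter, swap_comm]

/-- The sets stable under two permutations and not separating two points are trivial. -/
def TransitiveModulo (σ α : Perm D) (r b : D) : Prop :=
  ∀ x y p, Stable σ α p → (r ∈ p ↔ b ∈ p) → (x ∈ p ↔ y ∈ p)

/-- The new point is tied to `r` by the first permutation and to `b` by the second, so a stable set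
extends to it exactly when it does not separate `r` from `b`. -/
theorem jointlyTransitive_matchNone {σ α : Perm D} {r b : D} :
    JointlyTransitive (insertAfter σ r) (matchNone α b) ↔ TransitiveModulo σ α r b := by
  rw [matchNone_eq]
  constructor
  · intro h x y p hp hrb
    refine h (some x) (some y) (extendSet p r) ⟨insertAfter_mem_extendSet hp.1 r, fun z => ?_⟩
    have he : extendSet p r = extendSet p b := by
      ext (_ | z)
      · exact hrb
      · rfl
    rw [he]
    exact insertAfter_mem_extendSet hp.2 b z
  · intro h x y p hp
    obtain ⟨hr, hσ⟩ := mem_preimage_some_of_insertAfter hp.1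
    obtain ⟨hb, hα⟩ := mem_preimage_some_of_insertAfter hp.2
    have hst : Stable σ α (some ⁻¹' p) := ⟨hσ, hα⟩
    have key : ∀ x, x ∈ p ↔ some r ∈ p := by
      rintro (_ | x)
      · exact hr
      · exact h x r _ hst (hr.symm.trans hb)
    rw [key x, key y]

/-- An edge drawn inside a face cuts it in two, and an edge between two faces joins them. In terms
of permutations, one transposition inserts `none` between `b` and `φ b` in the face permutation `φ`,
then another one cuts or joins the cycles of `r` and `none`. -/
theorem sameCycle_insertAfter_inv_mul [Finite D] {σ α : Perm D} {r b : D} :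
    (σ⁻¹ * α).SameCycle r b ∧
      numCycles ((insertAfter σ r)⁻¹ * matchNone α b) = numCycles (σ⁻¹ * α) + 1 ∨
    ¬ (σ⁻¹ * α).SameCycle r b ∧
      numCycles ((insertAfter σ r)⁻¹ * matchNone α b) + 1 = numCycles (σ⁻¹ * α) := by
  set φ := σ⁻¹ * α with hφ
  have h1 : (insertAfter σ r)⁻¹ * matchNone α b =
      swap (some r) none * (swap none (some (φ b)) * optionCongr φ) := by
    rw [insertAfter_inv, matchNone, mul_assoc, ← mul_assoc (optionCongr σ⁻¹), ← optionCongr_mul,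
      ← hφ, mul_swap_eq_swap_mul]
    simp
  have hn := not_sameCycle_optionCongr φ (φ b)
  have h2 := numCycles_swap_mul_of_not hn
  rw [numCycles_optionCongr] at h2
  rw [h1]
  by_cases h : φ.SameCycle r b
  · refine Or.inl ⟨h, ?_⟩
    rw [numCycles_swap_mul_of_sameCycle (by simp)]
    · omega
    · have h3 : SameCycle (optionCongr φ) (some r) (some (φ b)) := by
        rw [sameCycle_optionCongr]
        exact sameCycle_apply_right.2 h
      exact (SameCycle.swap_mul_of_not hn h3).trans (SameCycle.of_swap_mul hn).symm
  · refine Or.inr ⟨h, ?_⟩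
    rw [numCycles_swap_mul_of_not]
    · omega
    · intro h3
      rcases sameCycle_swap_mul h3 with h4 | ⟨h4, -⟩ | ⟨h4, -⟩
      · exact not_sameCycle_optionCongr _ _ h4.symm
      · exact not_sameCycle_optionCongr _ _ h4.symm
      · rw [sameCycle_optionCongr] at h4
        exact h (sameCycle_apply_right.1 h4)

end

section Split

variable {p : D → Prop} [DecidablePred p]

theorem numCycles_subtypeCongr [Finite D] (f : Perm {x // p x}) (g : Perm {x // ¬ p x}) :
    numCycles (Perm.subtypeCongr f g) = numCycles f + numCycles g := by
  rw [Perm.subtypeCongr, numCycles_permCongr, numCycles_sumCongr]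

theorem subtypeCongr_inv_mul (f f' : Perm {x // p x}) (g g' : Perm {x // ¬ p x}) :
    (Perm.subtypeCongr f g)⁻¹ * Perm.subtypeCongr f' g' =
      Perm.subtypeCongr (f⁻¹ * f') (g⁻¹ * g') := by
  exact Perm.subtypeCongr.trans f' f⁻¹ g' g⁻¹

theorem subtypeCongr_subtypePerm (σ : Perm D) (h : ∀ x, p (σ x) ↔ p x) :
    Perm.subtypeCongr (σ.subtypePerm h) (σ.subtypePerm (p := fun x => ¬ p x) fun x => not_congr (h x)) =
      σ := by
  ext x
  by_cases hx : p x <;> simp [hx]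

theorem subtypeCongr_mem_iff (f : Perm {x // p x}) (g : Perm {x // ¬ p x}) (x : D) :
    p (Perm.subtypeCongr f g x) ↔ p x := by
  by_cases hx : p x
  · simp only [Perm.subtypeCongr.apply, hx, dif_pos, iff_true]
    exact (f ⟨x, hx⟩).2
  · simp only [Perm.subtypeCongr.apply, hx, dif_neg, iff_false, not_false_eq_true]
    exact (g ⟨x, hx⟩).2

theorem card_subtype_add_card_not [Finite D] (p : D → Prop) :
    Nat.card {x // p x} + Nat.card {x // ¬ p x} = Nat.card D := by
  classical
  rw [← Nat.card_sum, Nat.card_congr (Equiv.sumCompl p)]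

theorem jointlyTransitive_subtypePerm {σ α : Perm D} {p : D → Prop} (hσ : ∀ x, p (σ x) ↔ p x)
    (hα : ∀ x, p (α x) ↔ p x) (h : ∀ x y, p x → p y → compSetoid σ α x y) :
    JointlyTransitive (σ.subtypePerm hσ) (α.subtypePerm hα) := by
  rintro ⟨x, hx⟩ ⟨y, hy⟩ q hq
  have h1 := h x y hx hy {z | ∃ hz, ⟨z, hz⟩ ∈ q} ⟨fun z => ?_, fun z => ?_⟩
  · constructor
    · intro h2
      exact (h1.1 ⟨hx, h2⟩).2
    · intro h2
      exact (h1.2 ⟨hy, h2⟩).2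
  · constructor
    · rintro ⟨hz, h2⟩
      exact ⟨(hσ z).1 hz, (hq.1 ⟨z, (hσ z).1 hz⟩).1 h2⟩
    · rintro ⟨hz, h2⟩
      exact ⟨(hσ z).2 hz, (hq.1 ⟨z, hz⟩).2 h2⟩
  · constructor
    · rintro ⟨hz, h2⟩
      exact ⟨(hα z).1 hz, (hq.2 ⟨z, (hα z).1 hz⟩).1 h2⟩
    · rintro ⟨hz, h2⟩
      exact ⟨(hα z).2 hz, (hq.2 ⟨z, hz⟩).2 h2⟩

end Split

open Classical in
/-- The permutations split into two planar hypermaps, separating `r` from `b`. -/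
def SplitsPlanar (σ α : Perm D) (r b : D) : Prop :=
  ∃ T : Set D, r ∈ T ∧ b ∉ T ∧ ∃ (f f' : Perm {x // x ∈ T}) (g g' : Perm {x // ¬ x ∈ T}),
    IsPlanar f f' ∧ IsPlanar g g' ∧ σ = Perm.subtypeCongr f g ∧ α = Perm.subtypeCongr f' g'

/-- The value `Nat.card D + 4` is Euler's relation for two spheres. Euler's inequality shows that it
excludes a connected pair. As the inequality also holds in each of the two components, equality for
the sum forces equality in both. -/
theorem splitsPlanar_iff [Finite D] {σ α : Perm D} {r b : D}
    (hrb : ¬ (σ⁻¹ * α).SameCycle r b) :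
    SplitsPlanar σ α r b ↔ TransitiveModulo σ α r b ∧
      numCycles σ + numCycles α + numCycles (σ⁻¹ * α) = Nat.card D + 4 := by
  classical
  constructor
  · rintro ⟨T, hr, hb, f, f', g, g', hf, hg, rfl, rfl⟩
    constructor
    · intro x y p hp hrb
      have h1 : ∀ x (hx : x ∈ T), x ∈ p ↔ r ∈ p := fun x hx =>
        hf.1 ⟨x, hx⟩ ⟨r, hr⟩ {z | z.1 ∈ p} ⟨fun z => by
          have := hp.1 z.1
          rwa [Perm.subtypeCongr.left_apply_subtype] at this, fun z => by
          have := hp.2 z.1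
          rwa [Perm.subtypeCongr.left_apply_subtype] at this⟩
      have h2 : ∀ x (hx : x ∉ T), x ∈ p ↔ b ∈ p := fun x hx =>
        hg.1 ⟨x, hx⟩ ⟨b, hb⟩ {z | z.1 ∈ p} ⟨fun z => by
          have := hp.1 z.1
          rwa [Perm.subtypeCongr.right_apply_subtype] at this, fun z => by
          have := hp.2 z.1
          rwa [Perm.subtypeCongr.right_apply_subtype] at this⟩
      have h3 : ∀ x, x ∈ p ↔ r ∈ p := fun x => by
        by_cases hx : x ∈ T
        · exact h1 x hx
        · rw [h2 x hx, hrb]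
      rw [h3 x, h3 y]
    · rw [subtypeCongr_inv_mul, numCycles_subtypeCongr, numCycles_subtypeCongr,
        numCycles_subtypeCongr, ← card_subtype_add_card_not (· ∈ T)]
      have := hf.2
      have := hg.2
      omega
  · rintro ⟨htr, hcard⟩
    have hnt : ¬ compSetoid σ α r b := by
      intro h
      have : JointlyTransitive σ α := fun x y p hp => htr x y p hp (h p hp)
      have := this.numCycles_add_le
      omega
    obtain ⟨T, hT⟩ : ∃ T : Set D, ∀ x, x ∈ T ↔ compSetoid σ α r x :=
      ⟨{x | compSetoid σ α r x}, fun _ => Iff.rfl⟩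
    have hs : Stable σ α T := by
      have := compSetoid_stable σ α r
      exact ⟨fun z => by rw [hT, hT]; exact this.1 z, fun z => by rw [hT, hT]; exact this.2 z⟩
    have hb : ∀ x, x ∉ T → compSetoid σ α x b := by
      intro x hx p hp
      -- The test set agrees with `p` outside `T` and contains all or nothing of `T` according to
      -- whether `b ∈ p`; thus it does not separate `r` from `b`.
      have := htr x b {z | z ∈ T ∧ b ∈ p ∨ z ∉ T ∧ z ∈ p}
        ⟨fun z => by
          change (_ ∈ T ∧ _ ∨ _ ∉ T ∧ _ ∈ p) ↔ (_ ∈ T ∧ _ ∨ _ ∉ T ∧ _ ∈ p)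
          rw [hs.1, hp.1],
        fun z => by
          change (_ ∈ T ∧ _ ∨ _ ∉ T ∧ _ ∈ p) ↔ (_ ∈ T ∧ _ ∨ _ ∉ T ∧ _ ∈ p)
          rw [hs.2, hp.2]⟩
      have hr : r ∈ T := (hT r).2 ((compSetoid σ α).refl _)
      have hb : b ∉ T := fun h => hnt ((hT b).1 h)
      have h1 := this (by
        change (_ ∈ T ∧ _ ∨ _ ∉ T ∧ _ ∈ p) ↔ (_ ∈ T ∧ _ ∨ _ ∉ T ∧ _ ∈ p)
        tauto)
      change (_ ∈ T ∧ _ ∨ _ ∉ T ∧ _ ∈ p) ↔ (_ ∈ T ∧ _ ∨ _ ∉ T ∧ _ ∈ p) at h1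
      tauto
    have h1 := jointlyTransitive_subtypePerm (p := (· ∈ T)) hs.1 hs.2 fun x y hx hy =>
      (compSetoid σ α).trans ((compSetoid σ α).symm ((hT x).1 hx)) ((hT y).1 hy)
    have h2 := jointlyTransitive_subtypePerm (p := fun x => ¬ x ∈ T)
      (fun x => not_congr (hs.1 x)) (fun x => not_congr (hs.2 x)) fun x y hx hy =>
      (compSetoid σ α).trans (hb x hx) ((compSetoid σ α).symm (hb y hy))
    have h3 := subtypeCongr_subtypePerm (p := (· ∈ T)) σ hs.1
    have h4 := subtypeCongr_subtypePerm (p := (· ∈ T)) α hs.2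
    have h5 := h1.numCycles_add_le
    have h6 := h2.numCycles_add_le
    have h7 := congrArg numCycles h3
    have h8 := congrArg numCycles h4
    have h9 := congrArg₂ (fun a b => numCycles (a⁻¹ * b)) h3 h4
    rw [subtypeCongr_inv_mul] at h9
    rw [numCycles_subtypeCongr] at h7 h8 h9
    rw [← h7, ← h8, ← h9, ← card_subtype_add_card_not (· ∈ T)] at hcard
    exact ⟨T, (hT r).2 ((compSetoid σ α).refl _), fun h => hnt ((hT b).1 h), _, _, _, _,
      ⟨h1, by omega⟩, ⟨h2, by omega⟩, h3.symm, h4.symm⟩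

/-- Deletion of the root edge of a planar map. -/
theorem isPlanar_matchNone [Finite D] [DecidableEq D] {σ α : Perm D} {r b : D} :
    IsPlanar (insertAfter σ r) (matchNone α b) ↔
      (IsPlanar σ α ∧ (σ⁻¹ * α).SameCycle r b) ∨ SplitsPlanar σ α r b := by
  have hα : numCycles (matchNone α b) = numCycles α := by
    rw [matchNone_eq, numCycles_insertAfter]
  rw [IsPlanar, jointlyTransitive_matchNone, numCycles_insertAfter, hα, Finite.card_option]
  rcases sameCycle_insertAfter_inv_mul (σ := σ) (α := α) (r := r) (b := b) with ⟨h, h1⟩ | ⟨h, h1⟩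
  · have h2 : TransitiveModulo σ α r b ↔ JointlyTransitive σ α :=
      ⟨fun h' x y p hp => h' x y p hp (compSetoid_of_sameCycle_inv_mul h p hp),
        fun h' x y p hp _ => h' x y p hp⟩
    have h3 : ¬ SplitsPlanar σ α r b := by
      classical
      rintro ⟨T, hr, hb, f, f', g, g', -, -, rfl, rfl⟩
      refine hb (sameCycle_closed (p := T) (fun z hz => ?_) h hr)
      rw [subtypeCongr_inv_mul]
      exact (subtypeCongr_mem_iff (p := (· ∈ T)) _ _ z).2 hz
    rw [IsPlanar, h2, h1]
    simp only [h, h3, and_true, or_false]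
    refine and_congr_right fun _ => ?_
    omega
  · rw [splitsPlanar_iff h]
    simp only [h, and_false, false_or]
    refine and_congr_right fun _ => ?_
    omega

end Insertion

/-! ### Length of the root face after insertion of an edge. -/

section FaceLength

open Equiv Equiv.Perm Function

variable {D : Type*}

theorem minimalPeriod_eq_of_forall_ne {f : D → D} {x : D} {n : ℕ} (hn : 0 < n) (h : f^[n] x = x)
    (h' : ∀ j, 0 < j → j < n → f^[j] x ≠ x) : minimalPeriod f x = n := by
  have hp : IsPeriodicPt f n x := h
  refine le_antisymm (hp.minimalPeriod_le hn) (not_lt.1 fun hlt => ?_)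
  exact h' _ (hp.minimalPeriod_pos hn) hlt (isPeriodicPt_minimalPeriod f x)

theorem minimalPeriod_map {D' : Type*} {f : D → D} {g : D' → D'} {h : D → D'}
    (hi : Injective h) (H : Semiconj h f g) (x : D) :
    minimalPeriod g (h x) = minimalPeriod f x := by
  rw [minimalPeriod_eq_minimalPeriod_iff]
  intro n
  rw [IsPeriodicPt, IsFixedPt, IsPeriodicPt, IsFixedPt, ← (H.iterate_right n).eq]
  exact hi.eq_iff

theorem iterate_ne_of_lt_minimalPeriod {f : D → D} {x : D} {i j : ℕ} (hij : i < j)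
    (hj : j < minimalPeriod f x) : f^[j] x ≠ f^[i] x := fun h =>
  hij.ne' (iterate_injOn_Iio_minimalPeriod (Set.mem_Iio.2 hj) (Set.mem_Iio.2 (hij.trans hj)) h)

theorem iterate_ne_self {f : D → D} {x : D} {j : ℕ} (hj : 0 < j) (hj' : j < minimalPeriod f x) :
    f^[j] x ≠ x := iterate_ne_of_lt_minimalPeriod hj hj'

theorem sameCycle_iterate (φ : Perm D) (x : D) (j : ℕ) : φ.SameCycle x (φ^[j] x) :=
  ⟨j, by rw [zpow_natCast, ← iterate_eq_pow]⟩

/-- The length of the face cycle that contains `r`. -/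
noncomputable def faceLength (σ α : Perm D) (r : D) : ℕ := minimalPeriod (σ⁻¹ * α) r

theorem faceLength_pos [Finite D] (σ α : Perm D) (r : D) : 0 < faceLength σ α r :=
  minimalPeriod_pos_of_mem_periodicPts
    ((σ⁻¹ * α).injective.mem_periodicPts r)

theorem exists_iterate_of_sameCycle [Finite D] {φ : Perm D} {x y : D} (h : φ.SameCycle x y) :
    ∃ i < minimalPeriod φ x, φ^[i + 1] x = y := by
  have hpos : 0 < minimalPeriod φ x :=
    minimalPeriod_pos_of_mem_periodicPts (φ.injective.mem_periodicPts x)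
  obtain ⟨k, hk⟩ := (sameCycle_apply_left.2 h).exists_nat_pow_eq
  refine ⟨k % minimalPeriod φ x, Nat.mod_lt _ hpos, ?_⟩
  rw [iterate_succ_apply', iterate_mod_minimalPeriod_eq, ← hk, ← iterate_succ_apply' (⇑φ),
    ← iterate_eq_pow, iterate_succ_apply]

theorem faceLength_permCongr {D' : Type*} (e : D ≃ D') (σ α : Perm D) (r : D) :
    faceLength (e.permCongr σ) (e.permCongr α) (e r) = faceLength σ α r := by
  refine minimalPeriod_map e.injective (fun x => ?_) r
  rw [show (e.permCongr σ)⁻¹ = e.permCongr σ⁻¹ from rfl]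
  simp

section

variable [DecidableEq D]

theorem insertAfter_inv_some (σ : Perm D) (c y : D) :
    (insertAfter σ c)⁻¹ (some y) = if σ⁻¹ y = c then none else some (σ⁻¹ y) := by
  rw [insertAfter_inv, mul_apply]
  change swap (some c) none (some (σ⁻¹ y)) = _
  split_ifs with h
  · rw [h, swap_apply_left]
  · rw [swap_apply_of_ne_of_ne (by simpa using h) (by simp)]

theorem insertAfter_inv_none (σ : Perm D) (c : D) : (insertAfter σ c)⁻¹ none = some c := by
  rw [insertAfter_inv, mul_apply]
  exact swap_apply_right _ _

/-- With `φ = σ⁻¹ * α`, the joined face runs through the face of `r` starting at `r`, then `none`,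
then the face of `b` from `φ b` to `b`, and returns to `r`. The summand 1 is `none`. -/
theorem faceLength_matchNone_of_not_sameCycle [Finite D] {σ α : Perm D} {r b : D}
    (h : ¬ (σ⁻¹ * α).SameCycle r b) :
    faceLength (insertAfter σ r) (matchNone α b) (some r) =
      faceLength σ α r + faceLength σ α b + 1 := by
  have hrb : ∀ i j, (σ⁻¹ * α)^[i] r ≠ (σ⁻¹ * α)^[j] b := fun i j hij =>
    h ((sameCycle_iterate _ r i).trans (hij ▸ (sameCycle_iterate _ b j).symm))
  have hℓ := faceLength_pos σ α r
  have hℓ' := faceLength_pos σ α b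
  have e1 : ∀ y, y ≠ b → ((insertAfter σ r)⁻¹ * matchNone α b) (some y) =
      if (σ⁻¹ * α) y = r then none else some ((σ⁻¹ * α) y) := fun y hy => by
    rw [mul_apply, matchNone_some _ hy, insertAfter_inv_some, mul_apply]
  have e2 : ((insertAfter σ r)⁻¹ * matchNone α b) (some b) = some r := by
    rw [mul_apply, matchNone_self, insertAfter_inv_none]
  have e3 : ((insertAfter σ r)⁻¹ * matchNone α b) none = some ((σ⁻¹ * α) b) := by
    rw [mul_apply, matchNone_none, insertAfter_inv_some, ← mul_apply]
    exact if_neg (hrb 0 1).symm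
  unfold faceLength at *
  generalize (insertAfter σ r)⁻¹ * matchNone α b = ψ at *
  generalize σ⁻¹ * α = φ at *
  set k := minimalPeriod φ r with hk
  set l := minimalPeriod φ b with hl
  have f1 : ∀ j < k, ψ^[j] (some r) = some (φ^[j] r) := by
    intro j
    induction j with
    | zero => intro _; rfl
    | succ j ih =>
      intro hj
      rw [iterate_succ_apply', ih (by omega), e1 _ (hrb j 0), ← iterate_succ_apply' (⇑φ),
        if_neg (iterate_ne_self j.succ_pos hj)]
  have f2 : ψ^[k] (some r) = none := by
    obtain ⟨j, hj⟩ : ∃ j, k = j + 1 := ⟨k - 1, by omega⟩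
    rw [hj, iterate_succ_apply', f1 j (by omega), e1 _ (hrb j 0), ← iterate_succ_apply' (⇑φ)]
    refine if_pos ?_
    rw [Nat.succ_eq_add_one, ← hj, hk, iterate_minimalPeriod]
  have f3 : ∀ j < l, ψ^[k + (j + 1)] (some r) = some (φ^[j + 1] b) := by
    intro j
    induction j with
    | zero => intro _; rw [zero_add, iterate_succ_apply', f2, e3]; rfl
    | succ j ih =>
      intro hj
      rw [← add_assoc, iterate_succ_apply', ih (by omega), e1 _ (iterate_ne_self j.succ_pos hj),
        ← iterate_succ_apply' (⇑φ)]
      exact if_neg (hrb 0 _).symm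
  refine minimalPeriod_eq_of_forall_ne (by omega) ?_ fun j hj hj' => ?_
  · obtain ⟨j, hj⟩ : ∃ j, l = j + 1 := ⟨l - 1, by omega⟩
    rw [iterate_succ_apply', hj, f3 j (by omega), ← hj, hl, iterate_minimalPeriod, e2]
  · rcases lt_trichotomy j k with h1 | h1 | h1
    · rw [f1 j h1]
      exact fun h => iterate_ne_self hj h1 (Option.some_injective _ h)
    · rw [h1, f2]
      simp
    · obtain ⟨i, rfl⟩ : ∃ i, j = k + (i + 1) := ⟨j - k - 1, by omega⟩
      rw [f3 i (by omega)]
      exact fun h => hrb 0 (i + 1) (Option.some_injective _ h).symm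

/-- The far end of the new edge, `some none`, is put in a corner of the face of `r`. With `φ = σ⁻¹ *
α`, the new face of `r` is `r, φ r, …, φ^i r` followed by that end: `i + 1` old half-edges and a new
one. -/
theorem faceLength_matchNone_insertAfter [Finite D] {σ α : Perm D} {r : D} {i : ℕ}
    (hi : i < faceLength σ α r) :
    faceLength (insertAfter (insertAfter σ ((σ⁻¹ * α)^[i + 1] r)) (some r))
      (matchNone (optionCongr α) none) (some (some r)) = i + 2 := by
  set c := (σ⁻¹ * α)^[i + 1] r with hc
  have e1 : ∀ y, ((insertAfter (insertAfter σ c) (some r))⁻¹ * matchNone (optionCongr α) none)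
      (some (some y)) = if (σ⁻¹ * α) y = c then some none else if (σ⁻¹ * α) y = r then none else
        some (some ((σ⁻¹ * α) y)) := fun y => by
    rw [mul_apply, matchNone_some _ (by simp), insertAfter_inv_some, optionCongr_apply,
      Option.map_some, insertAfter_inv_some, mul_apply]
    generalize σ⁻¹ (α y) = z
    by_cases h : z = c
    · simp [h]
    · rw [if_neg h, if_neg h]
      simp
  have e2 : ((insertAfter (insertAfter σ c) (some r))⁻¹ * matchNone (optionCongr α) none)
      (some none) = some (some r) := by
    rw [mul_apply, matchNone_self, insertAfter_inv_none]
  unfold faceLength at *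
  generalize (insertAfter (insertAfter σ c) (some r))⁻¹ * matchNone (optionCongr α) none = ψ at *
  generalize σ⁻¹ * α = φ at *
  have f1 : ∀ j < i + 1, ψ^[j] (some (some r)) = some (some (φ^[j] r)) := by
    intro j
    induction j with
    | zero => intro _; rfl
    | succ j ih =>
      intro hj
      rw [iterate_succ_apply', ih (by omega), e1, ← iterate_succ_apply' (⇑φ),
        if_neg, if_neg (iterate_ne_self j.succ_pos (by omega))]
      rw [hc]
      -- For the largest `i` the corner `c` is that of `r` itself.
      rcases (show i + 1 ≤ minimalPeriod φ r from hi).eq_or_lt with h | h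
      · rw [h, iterate_minimalPeriod]
        exact iterate_ne_self j.succ_pos (by omega)
      · exact (iterate_ne_of_lt_minimalPeriod (by omega) h).symm
  have f2 : ψ^[i + 1] (some (some r)) = some none := by
    rw [iterate_succ_apply', f1 i (by omega), e1, ← iterate_succ_apply' (⇑φ)]
    exact if_pos hc.symm
  refine minimalPeriod_eq_of_forall_ne (by omega) ?_ fun j hj hj' => ?_
  · rw [iterate_succ_apply', f2, e2]
  · rcases (show j ≤ i + 1 by omega).eq_or_lt with h1 | h1
    · rw [h1, f2]
      simp
    · rw [f1 j h1]
      intro h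
      exact iterate_ne_self hj (by omega)
        (Option.some_injective _ (Option.some_injective _ h))

end

section Split

variable {T : Set D} [DecidablePred (· ∈ T)]

theorem faceLength_subtypeCongr_left (f f' : Perm {x // x ∈ T}) (g g' : Perm {x // ¬ x ∈ T})
    (r : {x // x ∈ T}) :
    faceLength (Perm.subtypeCongr f g) (Perm.subtypeCongr f' g') r = faceLength f f' r := by
  rw [faceLength, subtypeCongr_inv_mul]
  exact minimalPeriod_map Subtype.val_injective
    (fun x => (Perm.subtypeCongr.left_apply_subtype _ _ x).symm) r

theorem faceLength_subtypeCongr_right (f f' : Perm {x // x ∈ T}) (g g' : Perm {x // ¬ x ∈ T})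
    (r : {x // ¬ x ∈ T}) :
    faceLength (Perm.subtypeCongr f g) (Perm.subtypeCongr f' g') r = faceLength g g' r := by
  rw [faceLength, subtypeCongr_inv_mul]
  exact minimalPeriod_map Subtype.val_injective
    (fun x => (Perm.subtypeCongr.right_apply_subtype _ _ x).symm) r

theorem not_sameCycle_subtypeCongr [Finite D] (f f' : Perm {x // x ∈ T})
    (g g' : Perm {x // ¬ x ∈ T}) {r b : D} (hr : r ∈ T) (hb : b ∉ T) :
    ¬ ((Perm.subtypeCongr f g)⁻¹ * Perm.subtypeCongr f' g').SameCycle r b := by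
  intro h
  refine hb (sameCycle_closed (p := T) (fun z hz => ?_) h hr)
  rw [subtypeCongr_inv_mul]
  exact (subtypeCongr_mem_iff (p := (· ∈ T)) _ _ z).2 hz

end Split

theorem SplitsPlanar.not_sameCycle [Finite D] {σ α : Perm D} {r b : D}
    (h : SplitsPlanar σ α r b) : ¬ (σ⁻¹ * α).SameCycle r b := by
  classical
  obtain ⟨T, hr, hb, f, f', g, g', -, -, rfl, rfl⟩ := h
  exact not_sameCycle_subtypeCongr _ _ _ _ hr hb

end FaceLength

/-! ### Involutions with prescribed fixed points, under insertion and splitting. -/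

section LegInvolution

open Equiv Equiv.Perm

variable {D : Type*}

/-- An involution whose set of fixed points is `L`. -/
def IsLegInvolution (α : Perm D) (L : Set D) : Prop :=
  (∀ x, α (α x) = x) ∧ ∀ x, α x = x ↔ x ∈ L

theorem exists_eq_optionCongr {τ : Perm (Option D)} (h : τ none = none) :
    ∃ τ' : Perm D, τ = optionCongr τ' := by
  classical
  refine ⟨removeNone τ, ?_⟩
  rw [map_equiv_removeNone, h, swap_self]
  rfl

theorem isLegInvolution_optionCongr {α : Perm D} {L : Set D} :
    IsLegInvolution (optionCongr α) (insert none (some '' L)) ↔ IsLegInvolution α L := by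
  simp [IsLegInvolution, Option.forall]

theorem isLegInvolution_permCongr {D' : Type*} (e : D ≃ D') {α : Perm D} {r : D}
    (h : IsLegInvolution α {r}) : IsLegInvolution (e.permCongr α) {e r} := by
  refine ⟨fun x => by simp [h.1], fun x => ?_⟩
  have := h.2 (e.symm x)
  simpa [← Equiv.eq_symm_apply, Equiv.symm_apply_eq] using this

section

variable [DecidableEq D]

theorem exists_eq_insertAfter {σ : Perm (Option D)} {c : D} (h : σ (some c) = none) :
    ∃ σ' : Perm D, σ = insertAfter σ' c := by
  obtain ⟨σ', hσ'⟩ := exists_eq_optionCongr (τ := σ * swap (some c) none) (by simp [h])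
  refine ⟨σ', ?_⟩
  rw [insertAfter, ← hσ', mul_assoc, swap_mul_self, mul_one]

theorem insertAfter_injective (c : D) : Function.Injective fun σ : Perm D => insertAfter σ c :=
  fun _ _ h => optionCongr_injective (mul_right_cancel h)

theorem isLegInvolution_matchNone {α : Perm D} {r b : D} (hrb : r ≠ b) :
    IsLegInvolution (matchNone α b) {some r} ↔ IsLegInvolution α {r, b} := by
  constructor
  · rintro ⟨h1, h2⟩
    have hb : α b = b := by simpa using h1 (some b)
    have hb' : ∀ x, x ≠ b → α x ≠ b := fun x hx h => hx (α.injective (h.trans hb.symm))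
    refine ⟨fun x => ?_, fun x => ?_⟩
    · rcases eq_or_ne x b with rfl | hx
      · rw [hb, hb]
      · simpa [matchNone_some _ hx, matchNone_some _ (hb' x hx)] using h1 (some x)
    · rcases eq_or_ne x b with rfl | hx
      · simp [hb]
      · simpa [matchNone_some _ hx, hx] using h2 (some x)
  · rintro ⟨h1, h2⟩
    have hb : α b = b := (h2 b).2 (by simp)
    have hb' : ∀ x, x ≠ b → α x ≠ b := fun x hx h => hx (α.injective (h.trans hb.symm))
    refine ⟨?_, ?_⟩
    · rintro (_ | x)
      · simp [hb]
      · rcases eq_or_ne x b with rfl | hx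
        · simp [hb]
        · simp [matchNone_some _ hx, matchNone_some _ (hb' x hx), h1]
    · rintro (_ | x)
      · simp
      · rcases eq_or_ne x b with rfl | hx
        · simp [hrb.symm]
        · simp [matchNone_some _ hx, h2, hx]

theorem sameCycle_insertAfter_inv_mul_optionCongr [Finite D] {σ α : Perm D} {r c : D} :
    ((insertAfter σ c)⁻¹ * optionCongr α).SameCycle (some r) none ↔
      (σ⁻¹ * α).SameCycle r c := by
  have h1 : (insertAfter σ c)⁻¹ * optionCongr α = swap (some c) none * optionCongr (σ⁻¹ * α) := by
    rw [insertAfter_inv, mul_assoc, ← optionCongr_mul]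
  have hn : ∀ x, ¬ SameCycle (optionCongr (σ⁻¹ * α)) (some x) none :=
    fun x h => not_sameCycle_optionCongr _ x h.symm
  rw [h1, ← sameCycle_optionCongr (σ⁻¹ * α)]
  constructor
  · intro h
    rcases sameCycle_swap_mul h with h | ⟨h, -⟩ | ⟨h, -⟩
    · exact absurd h (hn r)
    · exact h
    · exact absurd h (hn r)
  · intro h
    exact (SameCycle.swap_mul_of_not (hn c) h).trans (SameCycle.of_swap_mul (hn c))

end

theorem isLegInvolution_subtypeCongr {T : Set D} [DecidablePred (· ∈ T)] {r b : D} (hr : r ∈ T)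
    (hb : b ∉ T) {f : Perm {x // x ∈ T}} {g : Perm {x // ¬ x ∈ T}} :
    IsLegInvolution (Perm.subtypeCongr f g) {r, b} ↔
      IsLegInvolution f {⟨r, hr⟩} ∧ IsLegInvolution g {⟨b, hb⟩} := by
  have hf : ∀ x (hx : x ∈ T), Perm.subtypeCongr f g x = f ⟨x, hx⟩ :=
    fun x hx => Perm.subtypeCongr.left_apply f g hx
  have hg : ∀ x (hx : x ∉ T), Perm.subtypeCongr f g x = g ⟨x, hx⟩ :=
    fun x hx => Perm.subtypeCongr.right_apply f g hx
  constructor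
  · rintro ⟨h1, h2⟩
    refine ⟨⟨?_, ?_⟩, ⟨?_, ?_⟩⟩
    · rintro ⟨x, hx⟩
      have := h1 x
      rw [hf x hx, hf _ (f ⟨x, hx⟩).2] at this
      exact Subtype.ext this
    · rintro ⟨x, hx⟩
      have := h2 x
      rw [hf x hx] at this
      rw [Subtype.ext_iff, this]
      have hxb : x ≠ b := fun h => hb (h ▸ hx)
      simp [hxb]
    · rintro ⟨x, hx⟩
      have := h1 x
      rw [hg x hx, hg _ (g ⟨x, hx⟩).2] at this
      exact Subtype.ext this
    · rintro ⟨x, hx⟩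
      have := h2 x
      rw [hg x hx] at this
      rw [Subtype.ext_iff, this]
      have hxb : x ≠ r := fun h => hx (h ▸ hr)
      simp [hxb]
  · rintro ⟨⟨h1, h2⟩, ⟨h3, h4⟩⟩
    refine ⟨fun x => ?_, fun x => ?_⟩
    · by_cases hx : x ∈ T
      · rw [hf x hx, hf _ (f ⟨x, hx⟩).2]
        exact congrArg Subtype.val (h1 ⟨x, hx⟩)
      · rw [hg x hx, hg _ (g ⟨x, hx⟩).2]
        exact congrArg Subtype.val (h3 ⟨x, hx⟩)
    · by_cases hx : x ∈ T
      · have hxb : x ≠ b := fun h => hb (h ▸ hx)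
        have := h2 ⟨x, hx⟩
        rw [Subtype.ext_iff] at this
        rw [hf x hx, this]
        simp [hxb]
      · have hxb : x ≠ r := fun h => hx (h ▸ hr)
        have := h4 ⟨x, hx⟩
        rw [Subtype.ext_iff] at this
        rw [hg x hx, this]
        simp [hxb]

/-- A splitting determines its set `T`, namely the component of `r`; this gives the injectivity in
`setSum_splits`. -/
theorem mem_iff_compSetoid {T : Set D} [DecidablePred (· ∈ T)] {r : D} (hr : r ∈ T)
    {f f' : Perm {x // x ∈ T}} (h : JointlyTransitive f f') (g g' : Perm {x // ¬ x ∈ T}) (x : D) :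
    x ∈ T ↔ compSetoid (Perm.subtypeCongr f g) (Perm.subtypeCongr f' g') r x := by
  constructor
  · intro hx p hp
    refine h ⟨r, hr⟩ ⟨x, hx⟩ {z | z.1 ∈ p} ⟨fun z => ?_, fun z => ?_⟩
    · have := hp.1 z.1
      rwa [Perm.subtypeCongr.left_apply_subtype] at this
    · have := hp.2 z.1
      rwa [Perm.subtypeCongr.left_apply_subtype] at this
  · intro h
    exact (h T ⟨fun z => subtypeCongr_mem_iff (p := (· ∈ T)) f g z,
      fun z => subtypeCongr_mem_iff (p := (· ∈ T)) f' g' z⟩).1 hr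

end LegInvolution

/-! ### Weighted sums over labelled maps and deletion of the edge after the root. -/

section MapSum

open Equiv Equiv.Perm

variable {D : Type*} {R : Type*} [CommRing R]

/-- A rooted planar map, the root being a half-edge. -/
def IsRootedMap (r : D) (σ α : Perm D) : Prop := IsLegInvolution α {r} ∧ IsPlanar σ α

/-- The weight of a rooted map: `u` per vertex, `x` per unit of length of the root face. -/
noncomputable def mapWeight (u x : R) (r : D) (p : Perm D × Perm D) : R :=
  u ^ numCycles p.1 * x ^ faceLength p.1 p.2 r

/-- Sum of a function over the elements of a set. -/
noncomputable def setSum {ι : Type*} [Finite ι] (s : Set ι) (f : ι → R) : R :=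
  ∑ i ∈ s.toFinite.toFinset, f i

theorem setSum_of_bijOn {ι κ : Type*} [Finite ι] [Finite κ] {s : Set ι} {t : Set κ} {f : ι → R}
    {g : κ → R} (e : ι → κ) (he : Set.BijOn e s t) (h : ∀ i ∈ s, f i = g (e i)) :
    setSum s f = setSum t g := by
  refine Finset.sum_nbij e (fun a ha => ?_) ?_ ?_ (fun a ha => h a (by simpa using ha))
  · simpa using he.mapsTo (by simpa using ha)
  · simpa using he.injOn
  · simpa using he.surjOn

theorem setSum_union {ι : Type*} [Finite ι] {s t : Set ι} (h : Disjoint s t) (f : ι → R) :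
    setSum (s ∪ t) f = setSum s f + setSum t f := by
  classical
  rw [setSum, setSum, setSum, ← Finset.sum_union]
  · congr 1
    ext
    simp
  · rw [Set.Finite.disjoint_toFinset]
    exact h

theorem setSum_sum {ι κ : Type*} [Finite ι] [Fintype κ] (s : Set ι) (f : ι → R) (g : ι → κ) :
    setSum s f = ∑ k, setSum {i | i ∈ s ∧ g i = k} f := by
  classical
  rw [setSum, ← Finset.sum_fiberwise _ g]
  refine Finset.sum_congr rfl fun k _ => ?_
  rw [setSum]
  congr 1
  ext
  simp

theorem setSum_sigma {κ : Type*} [Fintype κ] {ι : κ → Type*} [∀ k, Finite (ι k)]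
    (s : ∀ k, Set (ι k)) (f : ∀ k, ι k → R) :
    ∑ k, setSum (s k) (f k) = setSum {p : Σ k, ι k | p.2 ∈ s p.1} fun p => f p.1 p.2 := by
  unfold setSum
  rw [Finset.sum_sigma']
  congr 1
  ext
  simp

theorem setSum_mul_setSum {ι κ : Type*} [Finite ι] [Finite κ] (s : Set ι) (t : Set κ) (f : ι → R)
    (g : κ → R) : setSum s f * setSum t g = setSum (s ×ˢ t) fun p => f p.1 * g p.2 := by
  unfold setSum
  rw [Finset.sum_mul_sum, ← Finset.sum_product']
  congr 1
  ext
  simp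

/-- The weighted number of rooted maps with root `r`. -/
noncomputable def mapSum [Finite D] (u x : R) (r : D) : R :=
  setSum {p : Perm D × Perm D | IsRootedMap r p.1 p.2} (mapWeight u x r)

/-- The weighted number of rooted maps in which the root is followed by `a`, which is matched
with `b`. -/
noncomputable def edgeSum [Finite D] (u x : R) (r a b : D) : R :=
  setSum {p : Perm D × Perm D | IsRootedMap r p.1 p.2 ∧ p.1 r = a ∧ p.2 a = b} (mapWeight u x r)

theorem IsRootedMap.permCongr {D' : Type*} (e : D ≃ D') {r : D} {σ α : Perm D}
    (h : IsRootedMap r σ α) : IsRootedMap (e r) (e.permCongr σ) (e.permCongr α) :=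
  ⟨isLegInvolution_permCongr e h.1, h.2.permCongr e⟩

theorem mapWeight_permCongr {D' : Type*} (e : D ≃ D') (u x : R) (r : D) (p : Perm D × Perm D) :
    mapWeight u x (e r) (e.permCongr p.1, e.permCongr p.2) = mapWeight u x r p := by
  rw [mapWeight, mapWeight, numCycles_permCongr, faceLength_permCongr]

theorem mapSum_map [Finite D] {D' : Type*} [Finite D'] (e : D ≃ D') (u x : R) (r : D) :
    mapSum u x (e r) = mapSum u x r := by
  refine (setSum_of_bijOn (fun p => (e.permCongr p.1, e.permCongr p.2)) ⟨?_, ?_, ?_⟩ ?_).symm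
  · rintro p hp
    exact IsRootedMap.permCongr e hp
  · rintro p - q - h
    simpa [Prod.ext_iff] using h
  · rintro p hp
    refine ⟨(e.symm.permCongr p.1, e.symm.permCongr p.2), ?_, ?_⟩
    · have := IsRootedMap.permCongr e.symm hp
      rwa [Equiv.symm_apply_apply] at this
    · ext <;> simp
  · rintro p -
    exact (mapWeight_permCongr e u x r p).symm

theorem edgeSum_map_le [Finite D] (e : Perm D) (u x : R) (r a b : D) :
    edgeSum u x (e r) (e a) (e b) = edgeSum u x r a b := by
  refine (setSum_of_bijOn (fun p => (e.permCongr p.1, e.permCongr p.2)) ⟨?_, ?_, ?_⟩ ?_).symm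
  · rintro p ⟨hp, h1, h2⟩
    exact ⟨IsRootedMap.permCongr e hp, by simp [h1], by simp [h2]⟩
  · rintro p - q - h
    simpa [Prod.ext_iff] using h
  · rintro p ⟨hp, h1, h2⟩
    refine ⟨(e.symm.permCongr p.1, e.symm.permCongr p.2), ⟨?_, ?_, ?_⟩, ?_⟩
    · have := IsRootedMap.permCongr e.symm hp
      rwa [Equiv.symm_apply_apply] at this
    · simp [h1]
    · simp [h2]
    · ext <;> simp
  · rintro p -
    exact (mapWeight_permCongr e u x r p).symm

theorem mapSum_eq_of_card [Finite D] {D' : Type*} [Finite D'] (h : Nat.card D = Nat.card D')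
    (u x : R) (r : D) (r' : D') : mapSum u x r = mapSum u x r' := by
  classical
  obtain ⟨e⟩ := Finite.card_eq.1 h
  have : (e.trans (swap (e r) r')) r = r' := by simp
  rw [← this, mapSum_map]

/-- The relabelling `swap c b' * swap a a'`, where `c` is the image of `b` under `swap a a'`, fixes
`r` and carries `a`, `b` to `a'`, `b'`. -/
theorem edgeSum_eq [Finite D] {r a b a' b' : D} (ha : a ≠ r) (hb : b ≠ r) (hab : a ≠ b)
    (ha' : a' ≠ r) (hb' : b' ≠ r) (hab' : a' ≠ b') (u x : R) :
    edgeSum u x r a b = edgeSum u x r a' b' := by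
  classical
  set c := swap a a' b with hc
  have h1 : c ≠ a' := fun h => hab (by
    have : swap a a' b = swap a a' a := by rw [← hc, h, swap_apply_left]
    exact ((swap a a').injective this).symm)
  have h2 : c ≠ r := fun h => hb (by
    have : swap a a' b = swap a a' r := by
      rw [← hc, h, swap_apply_of_ne_of_ne ha.symm ha'.symm]
    exact (swap a a').injective this)
  rw [← edgeSum_map_le (swap c b' * swap a a')]
  simp only [mul_apply, swap_apply_left, ← hc]
  rw [swap_apply_of_ne_of_ne ha.symm ha'.symm, swap_apply_of_ne_of_ne h2.symm hb'.symm,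
    swap_apply_of_ne_of_ne h1.symm hab']

/-- Otherwise `{r}` would be stable under both permutations, against connectedness. -/
theorem IsRootedMap.apply_root_ne {r b : D} (hb : b ≠ r) {σ α : Perm D} (h : IsRootedMap r σ α) :
    σ r ≠ r := by
  intro hr
  refine hb (((h.2.1 r b) {r} ⟨fun z => ?_, fun z => ?_⟩).1 rfl)
  · rw [Set.mem_singleton_iff, Set.mem_singleton_iff]
    exact ⟨fun h => σ.injective (h.trans hr.symm), fun h => h ▸ hr⟩
  · have hα : α r = r := (h.1.2 r).2 rfl
    rw [Set.mem_singleton_iff, Set.mem_singleton_iff]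
    exact ⟨fun h => α.injective (h.trans hα.symm), fun h => h ▸ hα⟩

/-- The halves of the edge that follows the root are distinct and differ from the root. By symmetry
each of the `(m + 2) * (m + 1)` ordered pairs of such labels contributes the same amount. -/
theorem mapSum_eq_edgeSum [Finite D] {m : ℕ} (hD : Nat.card D = m + 3) {r a b : D} (ha : a ≠ r)
    (hb : b ≠ r) (hab : a ≠ b) (u x : R) :
    mapSum u x r = ((m + 2) * (m + 1) : ℕ) * edgeSum u x r a b := by
  classical
  have := Fintype.ofFinite D
  have h1 : mapSum u x r = ∑ k : D × D, edgeSum u x r k.1 k.2 := by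
    rw [mapSum, setSum_sum _ _ (fun p : Perm D × Perm D => (p.1 r, p.2 (p.1 r)))]
    refine Finset.sum_congr rfl fun k _ => ?_
    rw [edgeSum]
    congr 1
    ext p
    constructor
    · rintro ⟨h, rfl⟩
      exact ⟨h, rfl, rfl⟩
    · rintro ⟨h, h1, h2⟩
      exact ⟨h, Prod.ext h1 (by rw [← h2, ← h1])⟩
  have h2 : ∀ k ∉ (((Finset.univ : Finset D).erase r).offDiag),
      edgeSum u x r k.1 k.2 = 0 := by
    intro k hk
    refine Finset.sum_eq_zero fun p hp => ?_
    exfalso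
    obtain ⟨h, h1, h2⟩ : IsRootedMap r p.1 p.2 ∧ p.1 r = k.1 ∧ p.2 k.1 = k.2 := by
      simpa using hp
    refine hk ?_
    have h3 : k.1 ≠ r := h1 ▸ h.apply_root_ne ha
    have h4 : p.2 k.1 ≠ k.1 := fun h' => h3 (by simpa using (h.1.2 _).1 h')
    have h5 : p.2 k.1 ≠ r := fun h' => h3 (by
      rw [← h.1.1 k.1, h']
      exact (h.1.2 r).2 rfl)
    rw [h2] at h4 h5
    simpa [Finset.mem_offDiag, h3, h5] using h4.symm
  rw [h1, ← Finset.sum_subset (Finset.subset_univ _) fun k _ hk => h2 k hk]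
  rw [Finset.sum_congr rfl (g := fun _ => edgeSum u x r a b)]
  · rw [Finset.sum_const, Finset.offDiag_card, Finset.card_erase_of_mem (Finset.mem_univ _),
      Finset.card_univ, ← Nat.card_eq_fintype_card, hD, nsmul_eq_mul]
    congr 2
    simp only [show m + 3 - 1 = m + 2 from rfl]
    rw [← Nat.mul_sub_one]
    rfl
  · intro k hk
    simp only [Finset.mem_offDiag, Finset.mem_erase, Finset.mem_univ, and_true] at hk
    exact edgeSum_eq hk.1 hk.2.1 hk.2.2 ha hb hab u x

/-- The edge made of `none` and `some b` is deleted, which turns `b` into a second leg; the two sums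
are the two alternatives of `isPlanar_matchNone`. -/
theorem edgeSum_option [Finite D] [DecidableEq D] {r b : D} (hrb : r ≠ b) (u x : R) :
    edgeSum u x (some r) none (some b) =
      setSum {p : Perm D × Perm D | IsLegInvolution p.2 {r, b} ∧ IsPlanar p.1 p.2 ∧
        (p.1⁻¹ * p.2).SameCycle r b}
        (fun p => mapWeight u x (some r) (insertAfter p.1 r, matchNone p.2 b)) +
      setSum {p : Perm D × Perm D | IsLegInvolution p.2 {r, b} ∧ SplitsPlanar p.1 p.2 r b}
        (fun p => mapWeight u x (some r) (insertAfter p.1 r, matchNone p.2 b)) := by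
  rw [← setSum_union]
  · rw [edgeSum]
    symm
    refine setSum_of_bijOn (fun p : Perm D × Perm D => (insertAfter p.1 r, matchNone p.2 b))
      ⟨?_, ?_, ?_⟩ fun p _ => rfl
    · rintro p (⟨h1, h2⟩ | ⟨h1, h2⟩)
      · exact ⟨⟨(isLegInvolution_matchNone hrb).2 h1, isPlanar_matchNone.2 (Or.inl h2)⟩,
          insertAfter_self _ _, by simp [(h1.2 b).2 (by simp)]⟩
      · exact ⟨⟨(isLegInvolution_matchNone hrb).2 h1, isPlanar_matchNone.2 (Or.inr h2)⟩,
          insertAfter_self _ _, by simp [(h1.2 b).2 (by simp)]⟩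
    · rintro p - q - h
      rw [Prod.ext_iff] at h
      simp only [matchNone_eq] at h
      exact Prod.ext (insertAfter_injective r h.1) (insertAfter_injective b h.2)
    · rintro ⟨σ, α⟩ ⟨h, h1, h2⟩
      obtain ⟨σ', rfl⟩ := exists_eq_insertAfter h1
      have h3 : α (some b) = none := by
        rw [← h2]
        exact h.1.1 none
      obtain ⟨α', rfl⟩ := exists_eq_insertAfter h3
      rw [← matchNone_eq α' b] at h
      refine ⟨(σ', α'), ?_, by simp only [matchNone_eq]⟩
      have h4 := (isLegInvolution_matchNone hrb).1 h.1
      rcases isPlanar_matchNone.1 h.2 with h5 | h5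
      · exact Or.inl ⟨h4, h5⟩
      · exact Or.inr ⟨h4, h5⟩
  · rw [Set.disjoint_left]
    rintro p ⟨-, -, h⟩ ⟨-, h'⟩
    exact h'.not_sameCycle h

/-- The second leg is deleted as well. It could stand in any corner of the root face, and these
corners are the iterates of `r` of orders 1 to ℓ, the length of the face. So one map produces maps
whose root faces have lengths 2, …, ℓ + 1. -/
theorem setSum_sameCycle [Finite D] [DecidableEq D] (r : D) (u x : R) :
    setSum {p : Perm (Option D) × Perm (Option D) | IsLegInvolution p.2 {some r, none} ∧
        IsPlanar p.1 p.2 ∧ (p.1⁻¹ * p.2).SameCycle (some r) none}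
        (fun p => mapWeight u x (some (some r)) (insertAfter p.1 (some r), matchNone p.2 none)) =
      setSum {p : Perm D × Perm D | IsRootedMap r p.1 p.2} fun p =>
        ∑ i ∈ Finset.range (faceLength p.1 p.2 r), u ^ numCycles p.1 * x ^ (i + 2) := by
  rw [setSum, setSum, Finset.sum_sigma']
  symm
  have hleg : ∀ α : Perm D, IsLegInvolution (optionCongr α) {some r, none} ↔
      IsLegInvolution α {r} := fun α => by
    have := isLegInvolution_optionCongr (α := α) (L := {r})
    rwa [Set.image_singleton, Set.pair_comm] at this
  refine Finset.sum_nbij (fun q => (insertAfter q.1.1 ((q.1.1⁻¹ * q.1.2)^[q.2 + 1] r),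
    optionCongr q.1.2)) ?_ ?_ ?_ ?_
  · rintro ⟨⟨σ, α⟩, i⟩ hq
    simp only [Finset.mem_sigma, Set.Finite.mem_toFinset, Set.mem_ofPred_eq,
      Finset.mem_range] at hq ⊢
    exact ⟨(hleg α).2 hq.1.1, isPlanar_insertAfter.2 hq.1.2,
      sameCycle_insertAfter_inv_mul_optionCongr.2 (sameCycle_iterate _ _ _)⟩
  · rintro ⟨⟨σ, α⟩, i⟩ hq ⟨⟨σ', α'⟩, i'⟩ hq' h
    simp only [Finset.coe_sigma, Set.mem_sigma_iff, SetLike.mem_coe, Set.Finite.mem_toFinset,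
      Set.mem_ofPred_eq, Finset.mem_range, Prod.mk.injEq] at hq hq' h
    obtain ⟨h1, h2⟩ := h
    obtain rfl := optionCongr_injective h2
    have h3 : (σ⁻¹ * α)^[i + 1] r = (σ'⁻¹ * α)^[i' + 1] r := by
      have := insertAfter_self σ ((σ⁻¹ * α)^[i + 1] r)
      rw [h1, ← insertAfter_self σ' ((σ'⁻¹ * α)^[i' + 1] r)] at this
      exact Option.some_injective _ ((insertAfter σ' _).injective this)
    rw [h3] at h1
    obtain rfl := insertAfter_injective _ h1
    have h4 : i = i' := by
      rw [Function.iterate_succ_apply', Function.iterate_succ_apply'] at h3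
      exact Function.iterate_injOn_Iio_minimalPeriod hq.2 hq'.2 ((σ⁻¹ * α).injective h3)
    rw [h4]
  · rintro ⟨σ, α⟩ hq
    simp only [SetLike.mem_coe, Set.Finite.mem_toFinset, Set.mem_ofPred_eq] at hq
    obtain ⟨h1, h2, h3⟩ := hq
    obtain ⟨α, rfl⟩ := exists_eq_optionCongr ((h1.2 none).2 (by simp))
    obtain ⟨c, hc⟩ : ∃ c, σ (some c) = none := by
      -- If `none` were fixed by `σ`, it would form a face by itself, which could not contain the
      -- root.
      rcases hc : σ⁻¹ none with _ | c
      · exfalso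
        have h4 : (none : Option D) ∈ ({none}ᶜ : Set (Option D)) := by
          refine sameCycle_closed (p := {none}ᶜ) (fun z hz h => hz ?_) h3 (by simp)
          have h5 : (σ⁻¹ * optionCongr α) none = none := by
            rw [mul_apply]
            exact hc
          exact (σ⁻¹ * optionCongr α).injective ((show _ = none from h).trans h5.symm)
        simp at h4
      · exact ⟨c, by rw [← hc, ← mul_apply, mul_inv_cancel, one_apply]⟩
    obtain ⟨σ, rfl⟩ := exists_eq_insertAfter hc
    obtain ⟨i, hi, hi'⟩ := exists_iterate_of_sameCycle
      (sameCycle_insertAfter_inv_mul_optionCongr.1 h3)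
    refine ⟨⟨(σ, α), i⟩, ?_, by simp only [hi']⟩
    simp only [Finset.coe_sigma, Set.mem_sigma_iff, SetLike.mem_coe, Set.Finite.mem_toFinset,
      Set.mem_ofPred_eq, Finset.mem_range]
    exact ⟨⟨(hleg α).1 h1, isPlanar_insertAfter.1 h2⟩, hi⟩
  · rintro ⟨⟨σ, α⟩, i⟩ hq
    simp only [Finset.mem_sigma, Set.Finite.mem_toFinset, Set.mem_ofPred_eq,
      Finset.mem_range] at hq
    dsimp only [mapWeight]
    rw [faceLength_matchNone_insertAfter hq.2, numCycles_insertAfter, numCycles_insertAfter]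

/-- A geometric sum. It yields the divided difference of Tutte's equation, kept multiplied by `x -
1` so that no division is needed in `R`. -/
theorem mul_setSum_geom [Finite D] (r : D) (u x : R) :
    (x - 1) * (setSum {p : Perm D × Perm D | IsRootedMap r p.1 p.2} fun p =>
        ∑ i ∈ Finset.range (faceLength p.1 p.2 r), u ^ numCycles p.1 * x ^ (i + 2)) =
      x ^ 2 * (mapSum u x r - mapSum u 1 r) := by
  rw [mapSum, mapSum, setSum, setSum, setSum, Finset.mul_sum, ← Finset.sum_sub_distrib,
    Finset.mul_sum]
  refine Finset.sum_congr rfl fun p _ => ?_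
  have : ∑ i ∈ Finset.range (faceLength p.1 p.2 r), u ^ numCycles p.1 * x ^ (i + 2) =
      u ^ numCycles p.1 * x ^ 2 * ∑ i ∈ Finset.range (faceLength p.1 p.2 r), x ^ i := by
    rw [Finset.mul_sum]
    exact Finset.sum_congr rfl fun i _ => by ring
  rw [this, mapWeight, mapWeight]
  linear_combination u ^ numCycles p.1 * x ^ 2 * geom_sum_mul x (faceLength p.1 p.2 r)

/-- Vertex numbers add up, and the length of the joined face is the sum of the two root face lengths
plus one; the latter is the factor `x`. -/
theorem setSum_splits [Finite D] [DecidableEq D] (r b : D)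
    [Fintype {T : Set D // r ∈ T ∧ b ∉ T}] (u x : R) :
    setSum {p : Perm D × Perm D | IsLegInvolution p.2 {r, b} ∧ SplitsPlanar p.1 p.2 r b}
        (fun p => mapWeight u x (some r) (insertAfter p.1 r, matchNone p.2 b)) =
      ∑ T : {T : Set D // r ∈ T ∧ b ∉ T},
        x * (mapSum u x (⟨r, T.2.1⟩ : {y // y ∈ T.1}) *
          mapSum u x (⟨b, T.2.2⟩ : {y // ¬ y ∈ T.1})) := by
  classical
  simp only [mapSum]
  simp_rw [setSum_mul_setSum, ← Finset.mul_sum]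
  rw [setSum_sigma]
  rw [setSum, setSum, Finset.mul_sum]
  symm
  refine Finset.sum_nbij (fun q => (Perm.subtypeCongr (p := (· ∈ q.1.1)) q.2.1.1 q.2.2.1,
    Perm.subtypeCongr (p := (· ∈ q.1.1)) q.2.1.2 q.2.2.2)) ?_ ?_ ?_ ?_
  · rintro ⟨⟨T, hr, hb⟩, ⟨f, f'⟩, ⟨g, g'⟩⟩ hq
    simp only [Set.Finite.mem_toFinset, Set.mem_ofPred_eq, Set.mem_prod] at hq ⊢
    exact ⟨(isLegInvolution_subtypeCongr hr hb).2 ⟨hq.1.1, hq.2.1⟩,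
      T, hr, hb, f, f', g, g', hq.1.2, hq.2.2, rfl, rfl⟩
  · rintro ⟨⟨T, hr, hb⟩, ⟨f, f'⟩, ⟨g, g'⟩⟩ hq ⟨⟨T', hr', hb'⟩, ⟨k, k'⟩, ⟨l, l'⟩⟩ hq' h
    simp only [SetLike.mem_coe, Set.Finite.mem_toFinset, Set.mem_ofPred_eq, Set.mem_prod,
      Prod.mk.injEq] at hq hq' h
    have hT : T = T' := by
      ext y
      rw [mem_iff_compSetoid hr hq.1.2.1 g g' y, mem_iff_compSetoid hr' hq'.1.2.1 l l' y]
      rw [h.1, h.2]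
    subst hT
    have h1 := subtypeCongrHom_injective (· ∈ T) (a₁ := (f, g)) (a₂ := (k, l)) h.1
    have h2 := subtypeCongrHom_injective (· ∈ T) (a₁ := (f', g')) (a₂ := (k', l')) h.2
    simp only [Prod.mk.injEq] at h1 h2
    obtain ⟨rfl, rfl⟩ := h1
    obtain ⟨rfl, rfl⟩ := h2
    rfl
  · rintro ⟨σ, α⟩ hq
    simp only [SetLike.mem_coe, Set.Finite.mem_toFinset, Set.mem_ofPred_eq] at hq
    obtain ⟨h, T, hr, hb, f, f', g, g', h1, h2, rfl, rfl⟩ := hq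
    refine ⟨⟨⟨T, hr, hb⟩, (f, f'), (g, g')⟩, ?_, rfl⟩
    have h3 := (isLegInvolution_subtypeCongr hr hb).1 h
    simp only [SetLike.mem_coe, Set.Finite.mem_toFinset, Set.mem_ofPred_eq, Set.mem_prod]
    exact ⟨⟨h3.1, h1⟩, ⟨h3.2, h2⟩⟩
  · rintro ⟨⟨T, hr, hb⟩, ⟨f, f'⟩, ⟨g, g'⟩⟩ hq
    dsimp only [mapWeight]
    rw [faceLength_matchNone_of_not_sameCycle (not_sameCycle_subtypeCongr _ _ _ _ hr hb),
      numCycles_insertAfter, numCycles_subtypeCongr,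
      faceLength_subtypeCongr_left f f' g g' ⟨r, hr⟩,
      faceLength_subtypeCongr_right f f' g g' ⟨b, hb⟩]
    ring

end MapSum

/-! ### Tutte's recursion for labelled maps. -/

section Recursion

open Equiv Equiv.Perm

variable {R : Type*} [CommRing R]

/-- The weighted number of rooted maps whose set of half-edges is `Fin (m + 1)`, with root `0`. -/
noncomputable def stdMapSum (u x : R) (m : ℕ) : R := mapSum u x (0 : Fin (m + 1))

theorem mapSum_eq_stdMapSum {D : Type*} [Finite D] {m : ℕ} (h : Nat.card D = m + 1) (u x : R)
    (r : D) : mapSum u x r = stdMapSum u x m :=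
  mapSum_eq_of_card (by simpa using h) u x r _

theorem card_not_mem_of_card_mem {D : Type*} [Finite D] (T : Set D) {i j : ℕ}
    (hT : Nat.card {y // y ∈ T} = i) (hD : Nat.card D = i + j) : Nat.card {y // ¬ y ∈ T} = j := by
  have := card_subtype_add_card_not (· ∈ T)
  omega

/-- Sets of `Option (Option E)` which contain `some none` but not `none`. -/
noncomputable def separatingSetEquiv (E : Type*) [Fintype E] [DecidableEq E] :
    Finset E ≃ {T : Set (Option (Option E)) // some none ∈ T ∧ none ∉ T} where
  toFun S := ⟨((Finset.insertNone S).map Function.Embedding.some : Finset (Option (Option E))), by simp⟩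
  invFun T := by
    classical
    exact Finset.univ.filter fun e => some (some e) ∈ T.1
  left_inv S := by ext; simp
  right_inv T := by
    obtain ⟨T, h1, h2⟩ := T
    ext (_ | _ | e) <;> simp [h1, h2]

/-- The summand depends only on how many of the `m` half-edges other than the two legs lie on the
side of the first leg, whence the binomial coefficients. -/
theorem sum_separatingSet (E : Type*) [Fintype E] [DecidableEq E] {m : ℕ} (hE : Nat.card E = m)
    [Fintype {T : Set (Option (Option E)) // some none ∈ T ∧ none ∉ T}] (u x : R) :
    ∑ T : {T : Set (Option (Option E)) // some none ∈ T ∧ none ∉ T},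
        x * (mapSum u x (⟨some none, T.2.1⟩ : {y // y ∈ T.1}) *
          mapSum u x (⟨none, T.2.2⟩ : {y // ¬ y ∈ T.1})) =
      x * ∑ k ∈ Finset.HasAntidiagonal.antidiagonal m,
        (m.choose k.1 : R) * (stdMapSum u x k.1 * stdMapSum u x k.2) := by
  have hE' : Fintype.card E = m := by rw [← hE, Nat.card_eq_fintype_card]
  rw [← (separatingSetEquiv E).sum_comp, Finset.Nat.sum_antidiagonal_eq_sum_range_succ
    (fun i j => (m.choose i : R) * (stdMapSum u x i * stdMapSum u x j)), ← Finset.mul_sum]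
  congr 1
  have := Finset.sum_powerset_apply_card (fun i => stdMapSum u x i * stdMapSum u x (m - i))
    (x := (Finset.univ : Finset E))
  rw [Finset.card_univ, hE'] at this
  simp only [nsmul_eq_mul] at this
  rw [← this, Finset.powerset_univ]
  refine Finset.sum_congr rfl fun S _ => ?_
  have h1 : Nat.card {y // y ∈ ((separatingSetEquiv E) S).1} = S.card + 1 := by
    change Nat.card {y // y ∈ (((Finset.insertNone S).map Function.Embedding.some :
      Finset (Option (Option E))) : Set (Option (Option E)))} = _
    rw [Nat.card_coe_set_eq, Set.ncard_coe_finset]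
    simp
  have hS : S.card ≤ m := hE' ▸ Finset.card_le_univ S
  rw [mapSum_eq_stdMapSum h1, mapSum_eq_stdMapSum (m := m - S.card)
    (card_not_mem_of_card_mem _ h1 _)]
  rw [Finite.card_option, Finite.card_option, hE]
  omega

/-- Tutte's recursion on the edge that follows the root: among `m + 3` half-edges, two are labelled
as that edge in `(m + 2) * (m + 1)` ways. The difference comes from edges closing off a part of the
root face, the convolution from edges whose deletion disconnects. -/
theorem stdMapSum_add_two (u x : R) (m : ℕ) :
    (x - 1) * stdMapSum u x (m + 2) = ((m + 2) * (m + 1) : ℕ) *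
      (x ^ 2 * (stdMapSum u x m - stdMapSum u 1 m) +
        (x - 1) * (x * ∑ k ∈ Finset.HasAntidiagonal.antidiagonal m,
          (m.choose k.1 : R) * (stdMapSum u x k.1 * stdMapSum u x k.2))) := by
  classical
  have := Fintype.ofFinite
    {T : Set (Option (Option (Fin m))) // some none ∈ T ∧ none ∉ T}
  have h1 : stdMapSum u x (m + 2) = mapSum u x (some (some none) : Option (Option (Option (Fin m))))
    := (mapSum_eq_stdMapSum (by simp) _ _ _).symm
  rw [h1, mapSum_eq_edgeSum (m := m) (by simp) (a := none) (b := some none) (by simp) (by simp)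
    (by simp), edgeSum_option (by simp), setSum_sameCycle, setSum_splits,
    sum_separatingSet (Fin m) (m := m) (by simp)]
  have h2 := mul_setSum_geom (none : Option (Fin m)) u x
  rw [mapSum_eq_stdMapSum (m := m) (by simp), mapSum_eq_stdMapSum (m := m) (by simp)] at h2
  linear_combination ((m + 2) * (m + 1) : ℕ) * h2

theorem stdMapSum_zero (u x : R) : stdMapSum u x 0 = u * x := by
  have h1 : ∀ σ : Perm (Fin 1), σ = 1 := fun σ => Subsingleton.elim _ _
  have h2 : numCycles (1 : Perm (Fin 1)) = 1 := by simp [numCycles_one]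
  have h3 : {p : Perm (Fin 1) × Perm (Fin 1) | IsRootedMap 0 p.1 p.2} = {(1, 1)} := by
    ext p
    simp only [Set.mem_ofPred_eq, Set.mem_singleton_iff, Subsingleton.elim p (1, 1), iff_true]
    refine ⟨⟨fun _ => rfl, fun x => ?_⟩, ?_, ?_⟩
    · simp [Subsingleton.elim x 0]
    · intro x y p _
      rw [Subsingleton.elim x y]
    · simp [h2]
  have h4 : faceLength (1 : Perm (Fin 1)) 1 0 = 1 :=
    minimalPeriod_eq_of_forall_ne one_pos rfl fun j h h' => by omega
  change setSum {p : Perm (Fin 1) × Perm (Fin 1) | IsRootedMap 0 p.1 p.2} (mapWeight u x 0) = _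
  rw [h3, setSum, show (Set.toFinite {((1 : Perm (Fin 1)), (1 : Perm (Fin 1)))}).toFinset =
    {(1, 1)} from Finset.ext fun p => by
      rw [Set.Finite.mem_toFinset, Set.mem_singleton_iff, Finset.mem_singleton],
    Finset.sum_singleton, mapWeight, h2, h4, pow_one, pow_one]

end Recursion

/-! ### Substitution of a power series in t for the variable x, and differentiation in x. -/

section AdicEvaluation

open PowerSeries

/-- The sum of the terms of a power series whose coefficients are power series. -/
noncomputable def diagonal (P : ℚ⟦X⟧⟦X⟧) : ℚ⟦X⟧ :=
  PowerSeries.mk fun n => ∑ k ∈ Finset.HasAntidiagonal.antidiagonal n, coeff k.2 (coeff k.1 P)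

theorem diagonal_mul (P Q : ℚ⟦X⟧⟦X⟧) : diagonal (P * Q) = diagonal P * diagonal Q := by
  ext n
  simp only [diagonal, coeff_mk, coeff_mul, map_sum, Finset.sum_mul_sum]
  simp only [Finset.sum_sigma']
  refine Finset.sum_nbij'
    (fun s => ⟨(s.2.1.1 + s.2.2.1, s.2.1.2 + s.2.2.2), ⟨(s.2.1.1, s.2.2.1), (s.2.1.2, s.2.2.2)⟩⟩)
    (fun s => ⟨(s.2.1.1 + s.2.2.1, s.2.1.2 + s.2.2.2), ⟨(s.2.1.1, s.2.2.1), (s.2.1.2, s.2.2.2)⟩⟩)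
    ?_ ?_ ?_ ?_ ?_
  · rintro ⟨⟨i, j⟩, ⟨a, b⟩, ⟨c, d⟩⟩ h
    simp only [Finset.mem_sigma, Finset.HasAntidiagonal.mem_antidiagonal] at h ⊢
    exact ⟨by omega, trivial, trivial⟩
  · rintro ⟨⟨i, j⟩, ⟨a, b⟩, ⟨c, d⟩⟩ h
    simp only [Finset.mem_sigma, Finset.HasAntidiagonal.mem_antidiagonal] at h ⊢
    exact ⟨by omega, trivial, trivial⟩
  · rintro ⟨⟨i, j⟩, ⟨a, b⟩, ⟨c, d⟩⟩ h
    simp only [Finset.mem_sigma, Finset.HasAntidiagonal.mem_antidiagonal] at h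
    obtain ⟨-, rfl, rfl⟩ := h
    rfl
  · rintro ⟨⟨i, j⟩, ⟨a, b⟩, ⟨c, d⟩⟩ h
    simp only [Finset.mem_sigma, Finset.HasAntidiagonal.mem_antidiagonal] at h
    obtain ⟨-, rfl, rfl⟩ := h
    rfl
  · intro s _
    rfl

/-- The value of a power series with polynomial coefficients when a power series is substituted
for the polynomial variable. -/
noncomputable def substSeries (Y : ℚ⟦X⟧) : (Polynomial ℚ)⟦X⟧ →+* ℚ⟦X⟧ where
  toFun P := diagonal (PowerSeries.map (Polynomial.aeval Y : Polynomial ℚ →ₐ[ℚ] ℚ⟦X⟧).toRingHom P)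
  map_zero' := by ext n; simp [diagonal]
  map_add' P Q := by ext n; simp [diagonal, Finset.sum_add_distrib]
  map_one' := by
    ext n
    rw [map_one, diagonal, coeff_mk, Finset.sum_eq_single (0, n)]
    · simp
    · rintro ⟨i, j⟩ hk hne
      rw [Finset.HasAntidiagonal.mem_antidiagonal] at hk
      have : i ≠ 0 := by
        rintro rfl
        exact hne (by rw [← hk, zero_add])
      simp [coeff_one, this]
    · simp
  map_mul' P Q := by rw [map_mul, diagonal_mul]

theorem coeff_substSeries (Y : ℚ⟦X⟧) (P : (Polynomial ℚ)⟦X⟧) (n : ℕ) :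
    coeff n (substSeries Y P) = ∑ k ∈ Finset.HasAntidiagonal.antidiagonal n,
      coeff k.2 (Polynomial.aeval Y (coeff k.1 P)) := by
  change coeff n (diagonal _) = _
  simp [diagonal]

theorem substSeries_C (Y : ℚ⟦X⟧) (a : Polynomial ℚ) :
    substSeries Y (C a) = Polynomial.aeval Y a := by
  ext n
  rw [coeff_substSeries, Finset.sum_eq_single (0, n)]
  · simp
  · rintro ⟨i, j⟩ hk hne
    rw [Finset.HasAntidiagonal.mem_antidiagonal] at hk
    have : i ≠ 0 := by
      rintro rfl
      exact hne (by rw [← hk, zero_add])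
    simp [coeff_C, this]
  · simp

theorem substSeries_X (Y : ℚ⟦X⟧) : substSeries Y X = X := by
  ext n
  rw [coeff_substSeries]
  rcases n with _ | n
  · simp
  · rw [Finset.sum_eq_single (1, n)]
    · rcases n with _ | n <;> simp [coeff_X, coeff_one]
    · rintro ⟨i, j⟩ hk hne
      rw [Finset.HasAntidiagonal.mem_antidiagonal] at hk
      have : i ≠ 1 := by
        rintro rfl
        exact hne (by rw [Prod.mk.injEq]; omega)
      simp [coeff_X, this]
    · intro h
      exact absurd (Finset.HasAntidiagonal.mem_antidiagonal.2 (by omega)) h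

theorem substSeries_map_C (Y g : ℚ⟦X⟧) :
    substSeries Y (PowerSeries.map Polynomial.C g) = g := by
  ext n
  rw [coeff_substSeries, Finset.sum_eq_single (n, 0)]
  · simp
  · rintro ⟨i, j⟩ hk hne
    rw [Finset.HasAntidiagonal.mem_antidiagonal] at hk
    have : j ≠ 0 := by
      rintro rfl
      exact hne (by rw [← hk, add_zero])
    simp [coeff_C, this]
  · simp

theorem dvd_substSeries_sub {Y Z : ℚ⟦X⟧} {n : ℕ} (h : X ^ n ∣ Y - Z) (P : (Polynomial ℚ)⟦X⟧) :
    X ^ n ∣ substSeries Y P - substSeries Z P := by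
  rw [X_pow_dvd_iff]
  intro m hm
  rw [map_sub, coeff_substSeries, coeff_substSeries, ← Finset.sum_sub_distrib]
  refine Finset.sum_eq_zero fun k hk => ?_
  rw [Finset.HasAntidiagonal.mem_antidiagonal] at hk
  have h1 : X ^ n ∣ Polynomial.aeval Y (coeff k.1 P) - Polynomial.aeval Z (coeff k.1 P) := by
    refine h.trans ?_
    rw [Polynomial.aeval_def, Polynomial.aeval_def, ← Polynomial.eval_map, ← Polynomial.eval_map]
    exact Polynomial.sub_dvd_eval_sub _ _ _
  rw [← map_sub]
  exact X_pow_dvd_iff.1 h1 _ (by omega)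

/-- The fixed point theorem for the t-adic metric: the coefficient of order `n` is constant along
the iterates of 0 from the (n+1)-st on. -/
theorem exists_fixedPoint_of_contracting (T : ℚ⟦X⟧ → ℚ⟦X⟧)
    (hT : ∀ n Y Z, X ^ n ∣ Y - Z → X ^ (n + 1) ∣ T Y - T Z) : ∃ Y, T Y = Y := by
  have h1 : ∀ k, X ^ k ∣ T^[k + 1] 0 - T^[k] 0 := by
    intro k
    induction k with
    | zero => simp
    | succ k ih =>
      rw [Function.iterate_succ_apply' T (k + 1), Function.iterate_succ_apply' T k]
      rw [Function.iterate_succ_apply' T k] at ih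
      exact hT _ _ _ ih
  set Y : ℚ⟦X⟧ := PowerSeries.mk fun n => coeff n (T^[n + 1] 0) with hY
  have h2 : ∀ k, ∀ n < k, coeff n (T^[k] 0) = coeff n Y := by
    intro k
    induction k with
    | zero => intro n hn; omega
    | succ k ih =>
      intro n hn
      rcases Nat.lt_succ_iff_lt_or_eq.1 hn with h | rfl
      · rw [← ih n h, ← sub_eq_zero, ← map_sub]
        exact X_pow_dvd_iff.1 (h1 k) n h
      · rw [hY, coeff_mk]
  have h3 : ∀ k, X ^ k ∣ Y - T^[k] 0 := fun k => by
    rw [X_pow_dvd_iff]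
    intro n hn
    rw [map_sub, h2 k n hn, sub_self]
  refine ⟨Y, ?_⟩
  ext n
  rw [← h2 (n + 1) n n.lt_succ_self, ← sub_eq_zero, ← map_sub, Function.iterate_succ_apply']
  exact X_pow_dvd_iff.1 (hT n _ _ (h3 n)) n n.lt_succ_self

/-- Coefficientwise differentiation with respect to the polynomial variable. -/
noncomputable def derivX : Derivation ℚ (Polynomial ℚ)⟦X⟧ (Polynomial ℚ)⟦X⟧ :=
  Derivation.mk'
    { toFun := fun P => PowerSeries.mk fun n => Polynomial.derivative (coeff n P)
      map_add' := fun P Q => by ext1 n; simp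
      map_smul' := fun c P => by ext1 n; simp }
    fun P Q => by
      ext1 n
      simp only [LinearMap.coe_mk, AddHom.coe_mk, coeff_mk, smul_eq_mul, map_add, coeff_mul,
        Polynomial.derivative_sum, Polynomial.derivative_mul, Finset.sum_add_distrib]
      rw [add_comm, ← Finset.Nat.sum_antidiagonal_swap (n := n)
        (f := fun k => coeff k.1 Q * Polynomial.derivative (coeff k.2 P))]
      congr 1
      exact Finset.sum_congr rfl fun k _ => mul_comm _ _

theorem coeff_derivX (P : (Polynomial ℚ)⟦X⟧) (n : ℕ) :
    coeff n (derivX P) = Polynomial.derivative (coeff n P) := by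
  change coeff n (PowerSeries.mk fun n => Polynomial.derivative (coeff n P)) = _
  simp

theorem derivX_C (a : Polynomial ℚ) : derivX (C a) = C (Polynomial.derivative a) := by
  ext1 n
  rw [coeff_derivX, coeff_C, coeff_C]
  split_ifs <;> simp

theorem derivX_X : derivX X = 0 := by
  ext1 n
  rw [coeff_derivX, coeff_X]
  split_ifs <;> simp

theorem derivX_map_C (g : ℚ⟦X⟧) : derivX (PowerSeries.map Polynomial.C g) = 0 := by
  ext1 n
  simp [coeff_derivX]

end AdicEvaluation

/-! ### The quadratic method and its linearizations. -/

section Kernel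

open PowerSeries

/-- The scalar consequences of the kernel method. -/
theorem kernel_method {F G H : (Polynomial ℚ)⟦X⟧} {f g h : ℚ⟦X⟧} {x : (Polynomial ℚ)⟦X⟧}
    (hx : x = C Polynomial.X)
    (hF : (x - 1) * F = x * (x - 1) + X * (x ^ 2 * (F - PowerSeries.map Polynomial.C f) +
      (x - 1) * (x * F ^ 2)))
    (hG : (x - 1) * G = x * (x - 1) + X * (x ^ 2 * (G - PowerSeries.map Polynomial.C g) +
      (x - 1) * (x * (2 * F * G))))
    (hH : (x - 1) * H = X * (x ^ 2 * (H - PowerSeries.map Polynomial.C h) +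
      (x - 1) * (x * (2 * F * H + G ^ 2))))
    (hg : constantCoeff g = 1) :
    ∃ q : ℚ⟦X⟧, q = X * g ∧ g * (1 - 3 * q) = 1 ∧ f = g ^ 2 * (1 - 4 * q) ∧
      h * ((1 - 2 * q) * (1 - 6 * q)) = q := by
  -- `Y` is the root of the kernel `K` below. The equation `K = 0` at `x = Y` is written as a fixed
  -- point problem whose leading factor `X` makes it contracting.
  obtain ⟨Y, hY⟩ := exists_fixedPoint_of_contracting
    (fun Y => 1 + X * (Y ^ 2 + 2 * Y * (Y - 1) * substSeries Y F)) (by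
      intro n Y Z h
      obtain ⟨c, hc⟩ := h
      obtain ⟨d, hd⟩ := dvd_substSeries_sub ⟨c, hc⟩ F
      refine ⟨c * (Y + Z) + 2 * (c * (Y + Z - 1) * substSeries Y F + Z * (Z - 1) * d), ?_⟩
      rw [pow_succ]
      linear_combination (X * (Y + Z) + 2 * X * (Y + Z - 1) * substSeries Y F) * hc +
        2 * X * Z * (Z - 1) * hd)
  have hxY : substSeries Y x = Y := by rw [hx, substSeries_C, Polynomial.aeval_X]
  have hdx : derivX x = 1 := by rw [hx, derivX_C, Polynomial.derivative_X, map_one]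
  set t : ℚ⟦X⟧ := X with ht
  -- `K` is the derivative of Tutte's equation with respect to `F`; so it is also the coefficient of
  -- `G` and of `H` in the linearized equations.
  set K := (x - 1) - 2 * X * x * (x - 1) * F - X * x ^ 2 with hK
  have hKY : substSeries Y K = 0 := by
    simp only [hK, map_sub, map_mul, map_pow, map_one, map_ofNat, hxY, substSeries_X]
    linear_combination -hY
  have hKG : K * G = x * (x - 1) - X * x ^ 2 * PowerSeries.map Polynomial.C g := by
    linear_combination hG
  have hKH : K * H = X * x * (x - 1) * G ^ 2 - X * x ^ 2 * PowerSeries.map Polynomial.C h := by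
    linear_combination hH
  -- Completing the square eliminates `F`: the right-hand side is a polynomial Δ in `x` with `f` as
  -- only unknown. As `K` vanishes at `Y`, the root `Y` of Δ is double, and half the second
  -- derivative of Δ there is the square of `κ`, the value at `Y` of the derivative of `K`.
  have hKK : K * K = (x - 1 - X * x ^ 2) ^ 2 - 4 * X * (x * (x - 1)) ^ 2 +
      4 * X ^ 2 * x ^ 3 * (x - 1) * PowerSeries.map Polynomial.C f := by
    linear_combination (-4 * X * x * (x - 1)) * hF
  have hd : ∀ m : ℕ, derivX (m : (Polynomial ℚ)⟦X⟧) = 0 := fun m => derivX.map_natCast m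
  have hd2 : derivX 2 = 0 := hd 2
  have hd3 : derivX 3 = 0 := hd 3
  have hd4 : derivX 4 = 0 := hd 4
  have hd8 : derivX 8 = 0 := hd 8
  have hdK1 : K * derivX G + G * derivX K =
      2 * x - 1 - 2 * X * x * PowerSeries.map Polynomial.C g := by
    have := congrArg derivX hKG
    simp only [Derivation.leibniz, Derivation.leibniz_pow, map_sub,
      Derivation.map_one_eq_zero, hdx, derivX_X, derivX_map_C, smul_eq_mul,
      nsmul_eq_mul, Nat.cast_ofNat, Nat.reduceSub, pow_one] at this
    linear_combination this
  have hdK2 : 2 * (K * derivX K) = 2 * ((x - 1 - X * x ^ 2) * (1 - 2 * X * x)) -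
      8 * X * (x * (x - 1) * (2 * x - 1)) +
      4 * X ^ 2 * (4 * x ^ 3 - 3 * x ^ 2) * PowerSeries.map Polynomial.C f := by
    have := congrArg derivX hKK
    simp only [Derivation.leibniz, Derivation.leibniz_pow, map_sub, map_add,
      Derivation.map_one_eq_zero, hdx, derivX_X, derivX_map_C, hd4, smul_eq_mul,
      nsmul_eq_mul, Nat.cast_ofNat, Nat.reduceSub, pow_one] at this
    linear_combination this
  have hdK3 : 2 * (K * derivX (derivX K) + derivX K * derivX K) =
      2 * ((1 - 2 * X * x) ^ 2 - 2 * X * (x - 1 - X * x ^ 2)) -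
      8 * X * (6 * x ^ 2 - 6 * x + 1) +
      4 * X ^ 2 * (12 * x ^ 2 - 6 * x) * PowerSeries.map Polynomial.C f := by
    have := congrArg derivX hdK2
    simp only [Derivation.leibniz, Derivation.leibniz_pow, map_sub, map_add,
      Derivation.map_one_eq_zero, hdx, derivX_X, derivX_map_C, hd2, hd3, hd4, hd8, smul_eq_mul,
      nsmul_eq_mul, Nat.cast_ofNat, Nat.reduceSub, pow_one] at this
    linear_combination this
  -- At `x = Y` every multiple of `K` disappears: six relations between `Y`, `f`, `g`, `h`, `κ` and
  -- the value `γ` of `G` at `Y` remain.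
  have e1 := congrArg (substSeries Y) hKG
  have e2 := congrArg (substSeries Y) hKH
  have e3 := congrArg (substSeries Y) hKK
  have e4 := congrArg (substSeries Y) hdK1
  have e5 := congrArg (substSeries Y) hdK2
  have e6 := congrArg (substSeries Y) hdK3
  simp only [map_sub, map_add, map_mul, map_pow, map_one, map_ofNat, hxY, hKY,
    substSeries_X, substSeries_map_C, ← ht, zero_mul, mul_zero, zero_add] at e1 e2 e3 e4 e5 e6
  generalize substSeries Y (derivX K) = κ at *
  generalize substSeries Y G = γ at *
  have ht0 : t ≠ 0 := X_ne_zero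
  have hYc : constantCoeff Y = 1 := by
    have := congrArg constantCoeff hY
    simpa [ht] using this.symm
  have hg0 : g ≠ 0 := by
    rintro rfl
    simp at hg
  have hY0 : Y ≠ 0 := by
    intro h0
    rw [h0] at hYc
    simp at hYc
  have hq : Y - 1 = Y * (t * g) := by
    refine mul_left_cancel₀ hY0 ?_
    linear_combination -e1
  obtain ⟨q, hqd⟩ : ∃ q, q = t * g := ⟨_, rfl⟩
  have hq0 : q ≠ 0 := by
    rw [hqd]
    exact mul_ne_zero ht0 hg0
  rw [← hqd] at hq
  have hτ : t * Y ^ 2 = (Y - 1) * (3 - 2 * Y) := by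
    -- This is the elimination of `f` between Δ(Y) = 0 and Δ'(Y) = 0. The first factor is not zero,
    -- since it is `t * Y * (Y + g)` and `Y + g` has constant term 2.
    have h1 : (t * Y ^ 2 + (Y - 1)) * (t * Y ^ 2 - (Y - 1) * (3 - 2 * Y)) = 0 := by
      linear_combination (Y * (Y - 1)) * e5 - (4 * Y - 3) * e3
    have h2 : t * Y ^ 2 + (Y - 1) ≠ 0 := by
      have h3 : t * Y ^ 2 + (Y - 1) = t * (Y * (Y + g)) := by
        rw [hq, hqd]
        ring
      have h4 : Y + g ≠ 0 := by
        intro h0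
        have := congrArg constantCoeff h0
        rw [map_add, hYc, hg, map_zero] at this
        norm_num at this
      rw [h3]
      exact mul_ne_zero ht0 (mul_ne_zero hY0 h4)
    exact sub_eq_zero.1 ((mul_eq_zero.1 h1).resolve_left h2)
  have hg1 : g * (1 - 3 * q) = 1 := by
    refine mul_left_cancel₀ (mul_ne_zero ht0 (mul_ne_zero hY0 hY0)) ?_
    linear_combination -hτ - Y ^ 2 * (1 - 3 * q) * hqd + (3 * Y * q + 2 * Y - 3) * hq
  have htq : t = q * (1 - 3 * q) := by
    linear_combination -t * hg1 - (1 - 3 * q) * hqd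
  have hf : f = g ^ 2 * (1 - 4 * q) := by
    have h1 : q ^ 3 - t * q + t ^ 2 * f = 0 := by
      have h2 : 4 * Y ^ 4 * q * (q ^ 3 - t * q + t ^ 2 * f) = 0 := by
        have h3 : Y - 1 - t * Y ^ 2 = 2 * (Y * q) ^ 2 := by
          rw [hτ, ← hq]
          ring
        have h4 : 0 = (2 * (Y * q) ^ 2) ^ 2 - 4 * t * (Y * (Y * q)) ^ 2 +
            4 * t ^ 2 * Y ^ 3 * (Y * q) * f := by
          rw [← h3, ← hq]
          exact e3
        linear_combination -h4
      have h4 : (4 : ℚ⟦X⟧) ≠ 0 := fun h0 => by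
        have := congrArg constantCoeff h0
        rw [map_ofNat, map_zero] at this
        norm_num at this
      exact (mul_eq_zero.1 h2).resolve_left
        (mul_ne_zero (mul_ne_zero h4 (pow_ne_zero 4 hY0)) hq0)
    refine mul_left_cancel₀ (pow_ne_zero 2 ht0) ?_
    linear_combination h1 + q * htq + (1 - 4 * q) * (q + t * g) * hqd
  -- The second derivative of Δ at `Y`, rewritten in terms of `q` alone by means of `(1 - q) * Y =
  -- 1`, `t = q * (1 - 3 * q)` and the formula for `f`.
  have hκ : κ ^ 2 = (1 - 2 * q) * (1 - 6 * q) := by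
    have hYq : (1 - q) * Y = 1 := by linear_combination hq
    have h1q : (1 - q) ≠ 0 := left_ne_zero_of_mul_eq_one hYq
    have htf : t ^ 2 * f = q ^ 2 * (1 - 4 * q) := by
      rw [hf]
      linear_combination -(1 - 4 * q) * (q + t * g) * hqd
    refine mul_left_cancel₀ (pow_ne_zero 2 h1q) ?_
    have h2 : (2 : ℚ⟦X⟧) ≠ 0 := fun h0 => by
      have := congrArg constantCoeff h0
      rw [map_ofNat, map_zero] at this
      norm_num at this
    have h3 : κ ^ 2 = (6 * t ^ 2 - 24 * t + 24 * (q ^ 2 * (1 - 4 * q))) * Y ^ 2 +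
        (-6 * t + 24 * t - 12 * (q ^ 2 * (1 - 4 * q))) * Y + (1 + 2 * t - 4 * t) := by
      refine mul_left_cancel₀ h2 ?_
      linear_combination e6 + 4 * (12 * Y ^ 2 - 6 * Y) * htf
    rw [h3]
    set e := (6 * t ^ 2 - 24 * t + 24 * (q ^ 2 * (1 - 4 * q))) with he
    set e' := (-6 * t + 24 * t - 12 * (q ^ 2 * (1 - 4 * q))) with he'
    have h4 : (1 - q) ^ 2 * (e * Y ^ 2 + e' * Y + (1 + 2 * t - 4 * t)) =
        e + e' * (1 - q) + (1 + 2 * t - 4 * t) * (1 - q) ^ 2 := by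
      linear_combination (e * ((1 - q) * Y + 1) + e' * (1 - q)) * hYq
    rw [h4, he, he', htq]
    ring
  have hγ : γ * κ = 1 := by
    rw [e4]
    linear_combination 2 * hq + 2 * Y * hqd
  have hh : h = q * γ ^ 2 := by
    refine mul_left_cancel₀ (mul_ne_zero ht0 (pow_ne_zero 2 hY0)) ?_
    linear_combination e2 + t * Y * γ ^ 2 * hq
  refine ⟨q, hqd, hg1, hf, ?_⟩
  rw [← hκ, hh]
  linear_combination q * (γ * κ + 1) * hγ

end Kernel

/-! ### Coefficients of the explicit solution. -/

section Coefficients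

open PowerSeries

/-- Differentiating `X = q * (1 - 3 * q)` gives q' = 1/(1 − 6q), from which 2g = 2f + X f'. Partial
fractions give 4h = q' − 1/(1 − 2q); the coefficient of order n of q' is (n + 1) times that of g,
and those of 1/(1 − 2q) are nonnegative. -/
theorem coeff_relations {f g h q : ℚ⟦X⟧} (hq : q = X * g) (hg : g * (1 - 3 * q) = 1)
    (hf : f = g ^ 2 * (1 - 4 * q)) (hh : h * ((1 - 2 * q) * (1 - 6 * q)) = q)
    (n : ℕ) : 0 < coeff n g ∧ 2 * coeff n g = (n + 2) * coeff n f ∧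
      4 * coeff n h ≤ (n + 1) * coeff n g := by
  have hrec : g = 1 + 3 * (X * (g * g)) := by linear_combination hg + 3 * g * hq
  have hc3 : ∀ (P : ℚ⟦X⟧) (n : ℕ), coeff n (3 * P) = 3 * coeff n P := fun P n => by
    rw [show (3 : ℚ⟦X⟧) = C 3 from (map_ofNat C 3).symm, coeff_C_mul]
  have hc2 : ∀ (P : ℚ⟦X⟧) (n : ℕ), coeff n (2 * P) = 2 * coeff n P := fun P n => by
    rw [show (2 : ℚ⟦X⟧) = C 2 from (map_ofNat C 2).symm, coeff_C_mul]
  have hc4 : ∀ (P : ℚ⟦X⟧) (n : ℕ), coeff n (4 * P) = 4 * coeff n P := fun P n => by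
    rw [show (4 : ℚ⟦X⟧) = C 4 from (map_ofNat C 4).symm, coeff_C_mul]
  have hg0 : coeff 0 g = 1 := by
    rw [hrec, map_add, hc3]
    simp
  have hpos : ∀ n, 0 < coeff n g := by
    intro n
    induction n using Nat.strong_induction_on with
    | _ n ih =>
      rcases n with _ | n
      · rw [hg0]
        exact one_pos
      · rw [hrec, map_add, hc3, coeff_succ_X_mul, coeff_mul, coeff_one, if_neg n.succ_ne_zero,
          zero_add]
        refine mul_pos three_pos (Finset.sum_pos (fun k hk => ?_)
          ⟨(0, n), Finset.HasAntidiagonal.mem_antidiagonal.2 (zero_add n)⟩)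
        rw [Finset.HasAntidiagonal.mem_antidiagonal] at hk
        exact mul_pos (ih _ (by omega)) (ih _ (by omega))
  have hq0 : constantCoeff q = 0 := by simp [hq]
  set p := d⁄dX ℚ q with hp
  have hnat : ∀ m : ℕ, d⁄dX ℚ (m : ℚ⟦X⟧) = 0 := fun m => (d⁄dX ℚ).map_natCast m
  have hd3 : d⁄dX ℚ (3 : ℚ⟦X⟧) = 0 := hnat 3
  have hd4 : d⁄dX ℚ (4 : ℚ⟦X⟧) = 0 := hnat 4
  have hXq : X = q * (1 - 3 * q) := by linear_combination -X * hg - (1 - 3 * q) * hq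
  have hp1 : p * (1 - 6 * q) = 1 := by
    have := congrArg (d⁄dX ℚ) hXq
    simp only [Derivation.leibniz, map_sub, Derivation.map_one_eq_zero, hd3, smul_eq_mul,
      derivative_X, ← hp] at this
    linear_combination -this
  have hp2 : p = g + X * d⁄dX ℚ g := by
    have := congrArg (d⁄dX ℚ) hq
    simp only [Derivation.leibniz, smul_eq_mul, derivative_X, ← hp] at this
    linear_combination this
  have hf' : 2 * g = 2 * f + X * d⁄dX ℚ f := by
    have h1 := congrArg (d⁄dX ℚ) hf
    simp only [Derivation.leibniz, Derivation.leibniz_pow, map_sub, Derivation.map_one_eq_zero,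
      hd4, smul_eq_mul, nsmul_eq_mul, Nat.cast_ofNat, Nat.reduceSub, pow_one, ← hp] at h1
    rw [h1, hf]
    linear_combination -2 * g * hp1 + 2 * g * (1 - 4 * q) * hp2 - 4 * p * g * hq
  have hXd : ∀ (P : ℚ⟦X⟧) (n : ℕ), coeff n (X * d⁄dX ℚ P) = n * coeff n P := by
    intro P n
    rcases n with _ | n
    · simp
    · rw [coeff_succ_X_mul, coeff_derivative]
      push_cast
      ring
  refine ⟨hpos n, ?_, ?_⟩
  · have := congrArg (coeff n) hf'
    rw [map_add, hc2, hc2, hXd] at this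
    linear_combination this
  · have hu : constantCoeff (1 - 2 * q) ≠ 0 := by simp [hq0]
    set r := (1 - 2 * q)⁻¹ with hr
    have hr1 : r * (1 - 2 * q) = 1 := PowerSeries.inv_mul_cancel _ hu
    have hrrec : r = 1 + 2 * (X * (g * r)) := by linear_combination hr1 + 2 * r * hq
    have hrn : ∀ n, 0 ≤ coeff n r := by
      intro n
      induction n using Nat.strong_induction_on with
      | _ n ih =>
        rcases n with _ | n
        · rw [hrrec, map_add, hc2]
          simp
        · rw [hrrec, map_add, hc2, coeff_succ_X_mul, coeff_mul, coeff_one,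
            if_neg n.succ_ne_zero, zero_add]
          refine mul_nonneg zero_le_two (Finset.sum_nonneg fun k hk => ?_)
          rw [Finset.HasAntidiagonal.mem_antidiagonal] at hk
          exact mul_nonneg (hpos _).le (ih _ (by omega))
    have hh4 : 4 * h = p - r := by
      have h1 : (1 - 2 * q) * (1 - 6 * q) ≠ 0 :=
        mul_ne_zero (right_ne_zero_of_mul_eq_one hr1) (right_ne_zero_of_mul_eq_one hp1)
      refine mul_right_cancel₀ h1 ?_
      linear_combination 4 * hh - (1 - 2 * q) * hp1 + (1 - 6 * q) * hr1
    have := congrArg (coeff n) hh4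
    rw [hc4, map_sub, hp2, map_add, hXd] at this
    linarith [hrn n]

end Coefficients

/-! ### Normalization, expansion at u = 1 and the moment relations. -/

section Moments

open Equiv Equiv.Perm PowerSeries

variable {R : Type*} [CommRing R]

/-- An involution of a set of even size cannot have exactly one fixed point, so the sum is empty. -/
theorem stdMapSum_odd (u x : R) (n : ℕ) : stdMapSum u x (2 * n + 1) = 0 := by
  classical
  rw [stdMapSum, mapSum, setSum]
  refine Finset.sum_eq_zero fun p hp => ?_
  exfalso
  obtain ⟨⟨h1, h2⟩, -⟩ : IsRootedMap 0 p.1 p.2 := by simpa using hp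
  have h3 : (show Function.End (Fin (2 * n + 1 + 1)) from fun y => p.2 y) ^ 2 ^ 1 = 1 := funext h1
  have h4 := Equiv.Perm.card_fixedPoints_modEq h3
  have h5 : Fintype.card (Function.fixedPoints p.2) = 1 := by
    rw [Fintype.card_eq_one_iff]
    exact ⟨⟨0, (h2 0).2 rfl⟩, fun y => Subtype.ext ((h2 y.1).1 y.2)⟩
  rw [h5, Fintype.card_fin] at h4
  have : (2 * n + 1 + 1) % 2 = 1 % 2 := h4
  omega

/-- The exponential normalization of `stdMapSum`. -/
noncomputable def normMapSum [Algebra ℚ R] (u x : R) (n : ℕ) : R :=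
  algebraMap ℚ R ((2 * n).factorial : ℚ)⁻¹ * stdMapSum u x (2 * n)

theorem sum_antidiagonal_two_mul {M : Type*} [AddCommMonoid M] (F : ℕ → ℕ → M) (n : ℕ)
    (hF : ∀ i j, F (2 * i + 1) j = 0) :
    ∑ k ∈ Finset.HasAntidiagonal.antidiagonal (2 * n), F k.1 k.2 =
      ∑ k ∈ Finset.HasAntidiagonal.antidiagonal n, F (2 * k.1) (2 * k.2) := by
  symm
  refine Finset.sum_of_injOn (fun k => (2 * k.1, 2 * k.2)) ?_ ?_ ?_ fun _ _ => rfl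
  · rintro ⟨i, j⟩ - ⟨i', j'⟩ - h
    simpa using h
  · rintro ⟨i, j⟩ h
    simp only [Finset.mem_coe, Finset.HasAntidiagonal.mem_antidiagonal] at h ⊢
    omega
  · rintro ⟨i, j⟩ h h'
    rw [Finset.HasAntidiagonal.mem_antidiagonal] at h
    obtain ⟨a, ha⟩ := Nat.even_or_odd' i
    rcases ha with rfl | rfl
    · refine absurd ⟨(a, n - a), ?_, ?_⟩ h'
      · simp only [Finset.mem_coe, Finset.HasAntidiagonal.mem_antidiagonal]
        dsimp only at h
        omega
      · dsimp only at h ⊢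
        rw [Prod.mk.injEq]
        omega
    · exact hF a j

/-- Division by factorials absorbs the factor (2n + 2)(2n + 1) and turns the binomial convolution
into a Cauchy product; its odd terms vanish by `stdMapSum_odd`. -/
theorem normMapSum_succ [Algebra ℚ R] (u x : R) (n : ℕ) :
    (x - 1) * normMapSum u x (n + 1) = x ^ 2 * (normMapSum u x n - normMapSum u 1 n) +
      (x - 1) * (x * ∑ k ∈ Finset.HasAntidiagonal.antidiagonal n,
        normMapSum u x k.1 * normMapSum u x k.2) := by
  have h1 := stdMapSum_add_two u x (2 * n)
  rw [sum_antidiagonal_two_mul (fun i j => ((2 * n).choose i : R) *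
    (stdMapSum u x i * stdMapSum u x j)) n (fun i j => by simp [stdMapSum_odd])] at h1
  have h2 : algebraMap ℚ R ((2 * (n + 1)).factorial : ℚ)⁻¹ *
      ((2 * n + 2) * (2 * n + 1) : ℕ) = algebraMap ℚ R ((2 * n).factorial : ℚ)⁻¹ := by
    rw [← map_natCast (algebraMap ℚ R), ← map_mul]
    congr 1
    rw [show 2 * (n + 1) = 2 * n + 1 + 1 by ring, Nat.factorial_succ, Nat.factorial_succ]
    have : ((2 * n).factorial : ℚ) ≠ 0 := by positivity
    push_cast
    field_simp
    ring
  have h3 : algebraMap ℚ R ((2 * n).factorial : ℚ)⁻¹ *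
      ∑ k ∈ Finset.HasAntidiagonal.antidiagonal n, ((2 * n).choose (2 * k.1) : R) *
        (stdMapSum u x (2 * k.1) * stdMapSum u x (2 * k.2)) =
      ∑ k ∈ Finset.HasAntidiagonal.antidiagonal n, normMapSum u x k.1 * normMapSum u x k.2 := by
    rw [Finset.mul_sum]
    refine Finset.sum_congr rfl fun k hk => ?_
    rw [Finset.HasAntidiagonal.mem_antidiagonal] at hk
    have h4 : algebraMap ℚ R ((2 * n).factorial : ℚ)⁻¹ * ((2 * n).choose (2 * k.1) : R) =
        algebraMap ℚ R ((2 * k.1).factorial : ℚ)⁻¹ *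
          algebraMap ℚ R ((2 * k.2).factorial : ℚ)⁻¹ := by
      rw [← map_natCast (algebraMap ℚ R), ← map_mul, ← map_mul]
      congr 1
      rw [← hk, mul_add, Nat.cast_add_choose]
      have h5 : ((2 * k.1 + 2 * k.2).factorial : ℚ) ≠ 0 := by positivity
      field_simp
    rw [normMapSum, normMapSum]
    linear_combination stdMapSum u x (2 * k.1) * stdMapSum u x (2 * k.2) * h4
  rw [← h3]
  unfold normMapSum
  rw [show 2 * (n + 1) = 2 * n + 2 by ring] at h2 ⊢
  linear_combination algebraMap ℚ R ((2 * n + 2).factorial : ℚ)⁻¹ * h1 +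
    (x ^ 2 * (stdMapSum u x (2 * n) - stdMapSum u 1 (2 * n)) + (x - 1) * (x *
      ∑ k ∈ Finset.HasAntidiagonal.antidiagonal n, ((2 * n).choose (2 * k.1) : R) *
        (stdMapSum u x (2 * k.1) * stdMapSum u x (2 * k.2)))) * h2

/-- The normalized sum of the binomial coefficients `(#V).choose k` over rooted maps with `n`
edges. -/
noncomputable def binomMoment (k n : ℕ) : ℚ :=
  ((2 * n).factorial : ℚ)⁻¹ *
    setSum {p : Perm (Fin (2 * n + 1)) × Perm (Fin (2 * n + 1)) | IsRootedMap 0 p.1 p.2}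
      fun p => ((numCycles p.1).choose k : ℚ)

/-- The normalized sums of weights of rooted maps, as polynomials in the weight of the root face,
expanded around the value `1` of the weight per vertex. -/
noncomputable def facePoly (n : ℕ) : Polynomial (Polynomial ℚ) :=
  normMapSum (1 + Polynomial.X) (Polynomial.C Polynomial.X) n

theorem coeff_algebraMap_mul (c : ℚ) (P : Polynomial (Polynomial ℚ)) (k : ℕ) :
    (algebraMap ℚ (Polynomial (Polynomial ℚ)) c * P).coeff k =
      Polynomial.C c * P.coeff k := by
  rw [show algebraMap ℚ (Polynomial (Polynomial ℚ)) c = Polynomial.C (Polynomial.C c) from rfl,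
    Polynomial.coeff_C_mul]

theorem eval_coeff_facePoly (k n : ℕ) : ((facePoly n).coeff k).eval 1 = binomMoment k n := by
  rw [facePoly, normMapSum, coeff_algebraMap_mul, Polynomial.eval_mul, Polynomial.eval_C,
    binomMoment, stdMapSum, mapSum, setSum, setSum, Polynomial.finsetSum_coeff,
    Polynomial.eval_finsetSum]
  congr 1
  refine Finset.sum_congr rfl fun p _ => ?_
  rw [mapWeight, ← Polynomial.C_pow, Polynomial.coeff_mul_C, Polynomial.coeff_one_add_X_pow]
  simp

theorem coeff_normMapSum_one (k n : ℕ) :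
    (normMapSum (1 + Polynomial.X) (1 : Polynomial (Polynomial ℚ)) n).coeff k =
      Polynomial.C (binomMoment k n) := by
  rw [normMapSum, coeff_algebraMap_mul, binomMoment, stdMapSum, mapSum, setSum, setSum,
    Polynomial.finsetSum_coeff, map_mul, map_sum]
  congr 1
  refine Finset.sum_congr rfl fun p _ => ?_
  rw [mapWeight, one_pow, mul_one, Polynomial.coeff_one_add_X_pow]
  simp

theorem facePoly_zero : facePoly 0 = (1 + Polynomial.X) * Polynomial.C Polynomial.X := by
  rw [facePoly, normMapSum, mul_zero, stdMapSum_zero]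
  simp

theorem coeff_facePoly_succ (k n : ℕ) :
    (Polynomial.X - 1) * (facePoly (n + 1)).coeff k =
      Polynomial.X ^ 2 * ((facePoly n).coeff k - Polynomial.C (binomMoment k n)) +
      (Polynomial.X - 1) * (Polynomial.X * ∑ i ∈ Finset.HasAntidiagonal.antidiagonal n,
        (facePoly i.1 * facePoly i.2).coeff k) := by
  have h := congrArg (fun P : Polynomial (Polynomial ℚ) => P.coeff k)
    (normMapSum_succ (1 + Polynomial.X) (Polynomial.C (Polynomial.X : Polynomial ℚ)) n)
  rw [← Polynomial.C_1, ← Polynomial.C_sub, ← Polynomial.C_pow, Polynomial.coeff_add,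
    Polynomial.coeff_C_mul, Polynomial.coeff_C_mul, Polynomial.coeff_C_mul,
    Polynomial.coeff_C_mul, Polynomial.coeff_sub, Polynomial.C_1, coeff_normMapSum_one,
    Polynomial.finsetSum_coeff] at h
  exact h

/-- Tutte's equation is read in orders 0, 1 and 2 of the expansion in u − 1; these are the three
equations of `kernel_method`. -/
theorem binomMoment_relations (n : ℕ) :
    0 < binomMoment 0 n ∧ 2 * binomMoment 1 n = (n + 2) * binomMoment 0 n ∧
      4 * binomMoment 2 n ≤ (n + 1) * binomMoment 1 n := by
  set S : ℕ → (Polynomial ℚ)⟦X⟧ := fun k => PowerSeries.mk fun n => (facePoly n).coeff k with hS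
  set s : ℕ → ℚ⟦X⟧ := fun k => PowerSeries.mk (binomMoment k) with hs
  set x : (Polynomial ℚ)⟦X⟧ := C Polynomial.X with hx
  have hx1 : x - 1 = C (Polynomial.X - 1) := by rw [hx, map_sub, map_one]
  -- `T` stands for the part of order `k` in the square of the full series: `S 0 ^ 2`, `2 * S 0 * S
  -- 1` and `2 * S 0 * S 2 + S 1 ^ 2` below.
  have key : ∀ k (T : (Polynomial ℚ)⟦X⟧), (∀ n, coeff n T =
      ∑ i ∈ Finset.HasAntidiagonal.antidiagonal n, (facePoly i.1 * facePoly i.2).coeff k) →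
      (x - 1) * S k = (x - 1) * C ((facePoly 0).coeff k) +
        X * (x ^ 2 * (S k - PowerSeries.map Polynomial.C (s k)) + (x - 1) * (x * T)) := by
    intro k T hT
    ext1 n
    rcases n with _ | n
    · rw [hx1]
      simp [hS]
    · rw [hx1, map_add, coeff_succ_X_mul, hx, ← map_pow, map_add, coeff_C_mul, coeff_C_mul,
        coeff_C_mul, coeff_C_mul, coeff_C_mul, hT, coeff_C, if_neg n.succ_ne_zero, mul_zero,
        zero_add, map_sub, coeff_map]
      simp only [hS, hs, coeff_mk]
      exact coeff_facePoly_succ k n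
  -- The initial term is u x with u = 1 + (u − 1), hence nothing in order 2.
  have h0 : ∀ k, (facePoly 0).coeff k =
      if k = 0 ∨ k = 1 then Polynomial.X else 0 := by
    intro k
    rw [facePoly_zero, Polynomial.coeff_mul_C]
    rcases k with _ | _ | k
    · simp
    · simp [Polynomial.coeff_one]
    · simp [Polynomial.coeff_one, Polynomial.coeff_X]
  have hF := key 0 (S 0 ^ 2) fun n => by
    rw [sq, coeff_mul]
    refine Finset.sum_congr rfl fun i _ => ?_
    simp [hS, Polynomial.mul_coeff_zero]
  have hG := key 1 (2 * S 0 * S 1) fun n => by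
    rw [show 2 * S 0 * S 1 = S 0 * S 1 + S 1 * S 0 by ring, map_add, coeff_mul, coeff_mul,
      ← Finset.sum_add_distrib]
    refine Finset.sum_congr rfl fun i _ => ?_
    simp [hS, Polynomial.coeff_mul, Finset.Nat.antidiagonal_succ]
  have hH := key 2 (2 * S 0 * S 2 + S 1 ^ 2) fun n => by
    rw [show 2 * S 0 * S 2 + S 1 ^ 2 = S 0 * S 2 + S 1 * S 1 + S 2 * S 0 by ring, map_add, map_add,
      coeff_mul, coeff_mul, coeff_mul, ← Finset.sum_add_distrib, ← Finset.sum_add_distrib]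
    refine Finset.sum_congr rfl fun i _ => ?_
    simp [hS, Polynomial.coeff_mul, Finset.Nat.antidiagonal_succ]
    ring
  rw [h0, if_pos (by simp), ← hx] at hF hG
  rw [h0, if_neg (by simp), map_zero] at hH
  have hg : constantCoeff (s 1) = 1 := by
    rw [← coeff_zero_eq_constantCoeff_apply, hs]
    simp only [coeff_mk]
    rw [← eval_coeff_facePoly, h0]
    simp
  obtain ⟨q, hq, h1, h2, h3⟩ := kernel_method (F := S 0) (G := S 1) (H := S 2) (f := s 0) (g := s 1)
    (h := s 2) hx
    (by linear_combination hF) (by linear_combination hG) (by linear_combination hH) hg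
  obtain ⟨h4, h5, h6⟩ := coeff_relations hq h1 h2 h3 n
  simp only [hs, coeff_mk] at h4 h5 h6
  refine ⟨?_, h5, h6⟩
  by_contra h7
  have : ((n : ℚ) + 2) * binomMoment 0 n ≤ 0 :=
    mul_nonpos_of_nonneg_of_nonpos (by positivity) (not_lt.1 h7)
  linarith

end Moments

/-! ### From plane maps up to isomorphism to labelled maps with a leg. -/

section Labelled

open Equiv Equiv.Perm

variable {D : Type*}

theorem isPretransitive_closure_iff {σ α : Perm D} :
    MulAction.IsPretransitive (Subgroup.closure {σ, α}) D ↔ JointlyTransitive σ α := by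
  constructor
  · intro h x y p hp
    obtain ⟨⟨g, hg⟩, rfl⟩ := MulAction.exists_smul_eq (Subgroup.closure {σ, α}) x y
    have key : ∀ z, g z ∈ p ↔ z ∈ p := by
      induction hg using Subgroup.closure_induction with
      | mem g hg =>
        rcases hg with rfl | rfl
        exacts [hp.1, hp.2]
      | one => exact fun _ => Iff.rfl
      | mul f g _ _ hf hg => exact fun z => (hf (g z)).trans (hg z)
      | inv g _ hg => exact fun z => by simpa using (hg (g⁻¹ z)).symm
    exact (key x).symm
  · refine fun h => ⟨fun x y => ?_⟩
    have hs : ∀ f ∈ Subgroup.closure {σ, α}, ∀ z,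
        f z ∈ {z | ∃ g : Subgroup.closure {σ, α}, g • x = z} ↔
          z ∈ {z | ∃ g : Subgroup.closure {σ, α}, g • x = z} := by
      intro f hf z
      constructor
      · rintro ⟨g, hg⟩
        refine ⟨⟨f, hf⟩⁻¹ * g, ?_⟩
        rw [mul_smul, hg, inv_smul_eq_iff]
        rfl
      · rintro ⟨g, hg⟩
        refine ⟨⟨f, hf⟩ * g, ?_⟩
        rw [mul_smul, hg]
        rfl
    exact (h x y {z | ∃ g : Subgroup.closure {σ, α}, g • x = z}
      ⟨hs σ (Subgroup.subset_closure (by simp)), hs α (Subgroup.subset_closure (by simp))⟩).1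
      ⟨1, one_smul _ x⟩

theorem two_mul_numCycles_of_involution [Finite D] {α : Perm D} (h : ∀ x, α (α x) = x)
    (h' : ∀ x, α x ≠ x) : 2 * numCycles α = Nat.card D := by
  classical
  have := Fintype.ofFinite D
  have := Fintype.ofFinite (Cycles α)
  have key : ∀ x y, α.SameCycle x y ↔ y = x ∨ y = α x := by
    intro x y
    constructor
    · intro hxy
      refine (sameCycle_closed (p := {y | y = x ∨ y = α x}) ?_ hxy) (Or.inl rfl)
      rintro z (rfl | rfl)
      · exact Or.inr rfl
      · exact Or.inl (h x)
    · rintro (rfl | rfl)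
      · exact SameCycle.refl _ _
      · exact sameCycle_apply_self α x
  rw [numCycles, Nat.card_eq_fintype_card, Nat.card_eq_fintype_card, ← Finset.card_univ (α := D),
    Finset.card_eq_sum_card_fiberwise (f := fun x => (Quotient.mk _ x : Cycles α))
      (t := Finset.univ) (fun _ _ => Finset.mem_coe.2 (Finset.mem_univ _)),
    Finset.sum_const_nat (m := 2), Finset.card_univ, mul_comm]
  rintro ⟨x⟩ -
  rw [← Finset.card_pair (h' x)]
  congr 1
  ext y
  simp only [Finset.mem_filter, Finset.mem_univ, true_and, Finset.mem_insert,
    Finset.mem_singleton]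
  rw [show Quot.mk _ x = (Quotient.mk (SameCycle.setoid α) x) from rfl, Quotient.eq, or_comm,
    ← key]
  exact sameCycle_comm

theorem PlaneMap.isPlanar [Finite D] (m : PlaneMap D) : IsPlanar m.next m.rev := by
  refine ⟨isPretransitive_closure_iff.1 m.connected, ?_⟩
  have h1 := two_mul_numCycles_of_involution m.rev_rev m.rev_ne
  have h2 : numCycles m.next + numCycles (m.next⁻¹ * m.rev) = numCycles m.rev + 2 := m.euler
  omega

/-- The plane map defined by two permutations. -/
def PlaneMap.ofIsPlanar [Finite D] (σ α : Perm D) (h : ∀ x, α (α x) = x) (h' : ∀ x, α x ≠ x)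
    (hp : IsPlanar σ α) : PlaneMap D where
  next := σ
  rev := α
  rev_rev := h
  rev_ne := h'
  connected := isPretransitive_closure_iff.2 hp.1
  euler := by
    have h1 := two_mul_numCycles_of_involution h h'
    have h2 := hp.2
    rw [← h1] at h2
    change numCycles σ + numCycles (σ⁻¹ * α) = numCycles α + 2
    omega

/-- The plane map obtained by relabelling the oriented edges. -/
def PlaneMap.relabel [Finite D] (m : PlaneMap D) (f : Perm D) : PlaneMap D :=
  PlaneMap.ofIsPlanar (f.permCongr m.next) (f.permCongr m.rev) (fun x => by simp [m.rev_rev])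
    (fun x hx => m.rev_ne (f.symm x) (by simpa [← Equiv.eq_symm_apply] using hx))
    (m.isPlanar.permCongr f)

theorem PlaneMap.isIso_relabel [Finite D] (m : PlaneMap D) (f : Perm D) :
    m.IsIso (m.relabel f) f :=
  ⟨fun e => by simp [relabel, ofIsPlanar], fun e => by simp [relabel, ofIsPlanar]⟩

theorem PlaneMap.ext_of_eq {m m' : PlaneMap D} (h : m.next = m'.next) (h' : m.rev = m'.rev) :
    m = m' := by
  cases m
  cases m'
  subst h h'
  rfl

theorem PlaneMap.IsIso.eq_relabel [Finite D] {m m' : PlaneMap D} {f : Perm D}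
    (h : m.IsIso m' f) : m' = m.relabel f := by
  refine PlaneMap.ext_of_eq ?_ ?_
  · ext e
    simpa [relabel, ofIsPlanar] using congrArg id (h.1 (f.symm e)).symm
  · ext e
    simpa [relabel, ofIsPlanar] using congrArg id (h.2 (f.symm e)).symm

/-- Rooted plane maps have no nontrivial automorphism. -/
theorem PlaneMap.IsIso.eq_of_apply_eq [Finite D] {m m' : PlaneMap D} {f g : Perm D}
    (hf : m.IsIso m' f) (hg : m.IsIso m' g) {r : D} (hr : f r = g r) : f = g := by
  ext x
  refine (m.isPlanar.1 r x {z | f z = g z} ⟨fun z => ?_, fun z => ?_⟩).1 hr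
  · simp [hf.1, hg.1]
  · simp [hf.2, hg.2]

theorem PlaneMap.origin_eq_iff (m : PlaneMap D) {a b : D} :
    m.origin a = m.origin b ↔ m.next.SameCycle a b := Quotient.eq (r := SameCycle.setoid m.next)

variable {n : ℕ}

theorem LabelledRootedMap.ext_of_eq {m m' : LabelledRootedMap n} (h : m.next = m'.next)
    (h' : m.rev = m'.rev) (hr : m.root = m'.root) : m = m' := by
  cases m
  cases m'
  obtain rfl := PlaneMap.ext_of_eq h h'
  subst hr
  rfl

instance : Finite (LabelledRootedMap n) :=
  Finite.of_injective (fun m => (m.next, m.rev, m.root)) fun m m' h => by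
    simp only [Prod.mk.injEq] at h
    exact LabelledRootedMap.ext_of_eq h.1 h.2.1 h.2.2

instance : Finite (LabelledPointedMap n) :=
  Finite.of_injective
    (β := Σ m : LabelledRootedMap n, m.toPlaneMap.Vertex)
    (fun m => ⟨m.toLabelledRootedMap, m.point⟩)
    fun m m' h => by
      cases m
      cases m'
      simpa using h

instance : Finite (RootedMap n) := inferInstanceAs (Finite (Quotient _))

instance : Finite (PointedMap n) := inferInstanceAs (Finite (Quotient _))

/-- The rooted map represented by a labelled rooted map. -/
def LabelledRootedMap.toRootedMap (m : LabelledRootedMap n) : RootedMap n := Quotient.mk _ m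

/-- The pointed map represented by a labelled rooted map and one of its vertices. -/
def LabelledRootedMap.toPointedMap (m : LabelledRootedMap n) (v : m.toPlaneMap.Vertex) :
    PointedMap n := Quotient.mk _ ⟨m, v⟩

/-- The labelled rooted map obtained by relabelling. -/
def LabelledRootedMap.relabel (m : LabelledRootedMap n) (f : Perm (Fin (2 * n))) :
    LabelledRootedMap n := ⟨m.toPlaneMap.relabel f, f m.root⟩

/-- Relabellings act transitively on the fiber, and freely because rooted maps are rigid. -/
theorem LabelledRootedMap.card_fiber (m : LabelledRootedMap n) :
    Nat.card {m' : LabelledRootedMap n // m'.toRootedMap = m.toRootedMap} = (2 * n).factorial := by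
  have : Function.Bijective fun f : Perm (Fin (2 * n)) =>
      (⟨m.relabel f, (Quotient.sound (s := LabelledRootedMap.setoid n)
        ⟨f, m.isIso_relabel f, rfl⟩).symm⟩ :
        {m' : LabelledRootedMap n // m'.toRootedMap = m.toRootedMap}) := by
    constructor
    · intro f g h
      have h1 : m.relabel f = m.relabel g := congrArg Subtype.val h
      have h2 : m.toPlaneMap.relabel f = m.toPlaneMap.relabel g :=
        congrArg LabelledRootedMap.toPlaneMap h1
      have h3 : m.IsIso (m.toPlaneMap.relabel f) g := h2 ▸ m.isIso_relabel g
      exact (m.isIso_relabel f).eq_of_apply_eq h3 (congrArg LabelledRootedMap.root h1)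
    · rintro ⟨m', h⟩
      obtain ⟨f, hf, hr⟩ := Quotient.exact (s := LabelledRootedMap.setoid n) h.symm
      refine ⟨f, Subtype.ext ?_⟩
      have h1 := hf.eq_relabel
      exact LabelledRootedMap.ext_of_eq (congrArg PlaneMap.next h1).symm
        (congrArg PlaneMap.rev h1).symm hr
  rw [← Nat.card_congr (Equiv.ofBijective _ this), Nat.card_perm, Nat.card_fin]

/-- By rigidity again, distinct vertices of a rooted map give nonisomorphic pointed maps. -/
theorem LabelledRootedMap.card_pointed_fiber (m : LabelledRootedMap n) :
    Nat.card {p : PointedMap n // p.forget = m.toRootedMap} = m.toRootedMap.numVertices := by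
  have : Function.Bijective fun v : m.toPlaneMap.Vertex =>
      (⟨m.toPointedMap v, rfl⟩ : {p : PointedMap n // p.forget = m.toRootedMap}) := by
    constructor
    · intro v w h
      obtain ⟨f, hf, hr, hp⟩ := Quotient.exact (s := LabelledPointedMap.setoid n)
        (congrArg Subtype.val h)
      obtain rfl : f = 1 := hf.eq_of_apply_eq (PlaneMap.IsIso.refl _) hr
      induction v using Quotient.inductionOn with
      | h e => exact (hp e).1 rfl
    · rintro ⟨p, h⟩
      induction p using Quotient.inductionOn with
      | h p =>
        obtain ⟨f, hf, hr⟩ := Quotient.exact (s := LabelledRootedMap.setoid n) h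
        obtain ⟨e, he⟩ := Quotient.exists_rep p.point
        refine ⟨m.toPlaneMap.origin (f e), Subtype.ext (Eq.symm ?_)⟩
        refine Quotient.sound (s := LabelledPointedMap.setoid n) ⟨f, hf, hr, fun e' => ?_⟩
        rw [← he]
        exact p.origin_eq_iff.trans (hf.sameCycle.symm.trans m.origin_eq_iff.symm)
  exact (Nat.card_congr (Equiv.ofBijective _ this)).symm

theorem sum_labelledRootedMap [Fintype (LabelledRootedMap n)] [Fintype (RootedMap n)]
    {R : Type*} [CommSemiring R] (g : RootedMap n → R) :
    ∑ m : LabelledRootedMap n, g m.toRootedMap = ((2 * n).factorial : R) * ∑ m, g m := by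
  classical
  rw [← Finset.sum_fiberwise _ LabelledRootedMap.toRootedMap, Finset.mul_sum]
  refine Finset.sum_congr rfl fun q _ => ?_
  obtain ⟨m, rfl⟩ : ∃ m : LabelledRootedMap n, m.toRootedMap = q := Quotient.exists_rep q
  rw [Finset.sum_congr rfl (g := fun _ => g m.toRootedMap) fun m' hm' => by
    rw [(Finset.mem_filter.1 hm').2], Finset.sum_const, nsmul_eq_mul, ← m.card_fiber,
    Nat.card_eq_fintype_card, Fintype.card_subtype]

theorem isRootedMap_insertAfter (m : LabelledRootedMap n) :
    IsRootedMap none (insertAfter m.next m.root) (optionCongr m.rev) := by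
  refine ⟨?_, isPlanar_insertAfter.2 m.isPlanar⟩
  have h : IsLegInvolution m.rev ∅ := ⟨m.rev_rev, fun x => by simpa using m.rev_ne x⟩
  simpa using isLegInvolution_optionCongr.2 h

/-- The leg keeps track of the root as its predecessor around the vertex. For `n = 0` the single
vertex carrying only the leg would have no preimage. -/
theorem bijOn_insertAfter (hn : n ≠ 0) :
    Set.BijOn (fun m : LabelledRootedMap n => (insertAfter m.next m.root, optionCongr m.rev))
      Set.univ {p : Perm (Option (Fin (2 * n))) × Perm (Option (Fin (2 * n))) |
        IsRootedMap none p.1 p.2} := by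
  refine ⟨fun m _ => isRootedMap_insertAfter m, fun m _ m' _ h => ?_, ?_⟩
  · simp only [Prod.mk.injEq] at h
    have hr : m.root = m'.root := by
      refine Option.some_injective _ ((insertAfter m.next m.root).injective ?_)
      rw [insertAfter_self, h.1, insertAfter_self]
    refine LabelledRootedMap.ext_of_eq (insertAfter_injective m.root ?_)
      (optionCongr_injective h.2) hr
    beta_reduce
    rw [h.1, hr]
  · rintro ⟨σ, α⟩ ⟨h1, h2⟩
    have hα : α none = none := (h1.2 none).2 rfl
    obtain ⟨α, rfl⟩ := exists_eq_optionCongr hα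
    obtain ⟨c, hc⟩ : ∃ c, σ (some c) = none := by
      -- A leg alone at its vertex would be a component by itself, while other half-edges exist.
      rcases h : σ⁻¹ none with _ | c
      · have h3 : ∀ τ : Perm (Option (Fin (2 * n))), τ none = none → ∀ z,
            τ z ∈ ({none} : Set (Option (Fin (2 * n)))) ↔ z ∈ ({none} : Set _) := by
          intro τ hτ z
          rw [Set.mem_singleton_iff, Set.mem_singleton_iff, ← hτ, τ.injective.eq_iff, hτ]
        have := (h2.1 none (some ⟨0, by omega⟩) {none}
          ⟨h3 σ (Perm.inv_eq_iff_eq.1 h).symm, h3 _ hα⟩).1 rfl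
        cases this
      · exact ⟨c, (Perm.inv_eq_iff_eq.1 h).symm⟩
    obtain ⟨σ, rfl⟩ := exists_eq_insertAfter hc
    have h3 : IsLegInvolution α ∅ := isLegInvolution_optionCongr.1 (by simpa using h1)
    exact ⟨⟨PlaneMap.ofIsPlanar σ α h3.1 (fun x hx => (h3.2 x).1 hx)
      (isPlanar_insertAfter.1 h2), c⟩, Set.mem_univ _, rfl⟩

theorem setSum_isRootedMap_permCongr {R : Type*} [CommRing R] {D' : Type*} [Finite D] [Finite D']
    (e : D ≃ D') (r : D) (g : ℕ → R) :
    setSum {p : Perm D × Perm D | IsRootedMap r p.1 p.2} (fun p => g (numCycles p.1)) =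
      setSum {p : Perm D' × Perm D' | IsRootedMap (e r) p.1 p.2} (fun p => g (numCycles p.1)) := by
  refine setSum_of_bijOn (fun p => (e.permCongr p.1, e.permCongr p.2)) ⟨?_, ?_, ?_⟩ ?_
  · rintro p hp
    exact IsRootedMap.permCongr e hp
  · rintro p - q - h
    simpa [Prod.ext_iff] using h
  · rintro p hp
    refine ⟨(e.symm.permCongr p.1, e.symm.permCongr p.2), ?_, ?_⟩
    · have := IsRootedMap.permCongr e.symm hp
      rwa [Equiv.symm_apply_apply] at this
    · ext <;> simp
  · rintro p -
    rw [numCycles_permCongr]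

theorem sum_choose_numVertices (hn : n ≠ 0) [Fintype (RootedMap n)] (k : ℕ) :
    ∑ m : RootedMap n, (m.numVertices.choose k : ℚ) = binomMoment k n := by
  have := Fintype.ofFinite (LabelledRootedMap n)
  have h := setSum_of_bijOn (f := fun m : LabelledRootedMap n =>
    ((m.toRootedMap.numVertices.choose k : ℕ) : ℚ)) (g := fun p => ((numCycles p.1).choose k : ℚ))
    _ (bijOn_insertAfter hn) fun m _ => by
      rw [numCycles_insertAfter]
      rfl
  rw [setSum_isRootedMap_permCongr (finSuccEquiv (2 * n)).symm none fun a => (a.choose k : ℚ),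
    finSuccEquiv_symm_none, setSum] at h
  rw [binomMoment, ← h, eq_inv_mul_iff_mul_eq₀ (by positivity), ← sum_labelledRootedMap]
  refine Finset.sum_congr ?_ fun _ _ => rfl
  ext
  simp

theorem card_pointedMap [Fintype (RootedMap n)] :
    Nat.card (PointedMap n) = ∑ m : RootedMap n, m.numVertices := by
  rw [← Nat.card_congr (Equiv.sigmaFiberEquiv (PointedMap.forget (n := n))), Nat.card_sigma]
  refine Finset.sum_congr rfl fun q _ => ?_
  obtain ⟨m, rfl⟩ : ∃ m : LabelledRootedMap n, m.toRootedMap = q := Quotient.exists_rep q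
  exact m.card_pointed_fiber

end Labelled

/-! ### Total variation and quadratic estimates from the two moments. -/

section Measures

theorem abs_apply_le_sum_singleton {X : Type*} [Fintype X] [MeasurableSpace X]
    [MeasurableSingletonClass X] (s : SignedMeasure X) (A : Finset X) :
    |s (A : Set X)| ≤ ∑ x ∈ A, |s {x}| := by
  have h : s (⋃ x ∈ A, {x}) = ∑ x ∈ A, s {x} :=
    VectorMeasure.of_biUnion_finset (fun x _ y _ hxy => by simpa using hxy)
      fun x _ => measurableSet_singleton x
  rw [← Finset.set_biUnion_coe, Set.biUnion_of_singleton] at h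
  rw [h]
  exact Finset.abs_sum_le_sum_abs _ _

/-- By a Hahn decomposition, the total variation is the mass of the positive part minus the signed
mass of its complement, and each is bounded pointwise. -/
theorem tvNorm_le_sum_singleton {X : Type*} [Fintype X] [MeasurableSpace X]
    [MeasurableSingletonClass X] (s : SignedMeasure X) : tvNorm s ≤ ∑ x, |s {x}| := by
  classical
  obtain ⟨i, hi, h1, h2, h3, h4⟩ := s.toJordanDecomposition_spec
  rw [tvNorm, SignedMeasure.totalVariation, measureReal_add_apply, h3, h4,
    SignedMeasure.toMeasureOfZeroLE_real_apply s h1 hi MeasurableSet.univ,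
    SignedMeasure.toMeasureOfLEZero_real_apply s h2 hi.compl MeasurableSet.univ, Set.inter_univ,
    Set.inter_univ, ← Finset.sum_add_sum_compl (Set.toFinset i)]
  have h5 := abs_apply_le_sum_singleton s i.toFinset
  have h6 := abs_apply_le_sum_singleton s i.toFinsetᶜ
  rw [Finset.coe_compl, Set.coe_toFinset] at h6
  rw [Set.coe_toFinset] at h5
  exact add_le_add ((le_abs_self _).trans h5) ((neg_le_abs _).trans h6)

instance (n : ℕ) : DiscreteMeasurableSpace (RootedMap n) := ⟨fun _ => trivial⟩

instance (n : ℕ) : DiscreteMeasurableSpace (PointedMap n) := ⟨fun _ => trivial⟩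

theorem uniformOn_univ_real {X : Type*} [Finite X] [MeasurableSpace X]
    [DiscreteMeasurableSpace X] (s : Set X) :
    (uniformOn (Set.univ : Set X)).real s = (Nat.card s : ℝ) / Nat.card X := by
  have := Fintype.ofFinite X
  rw [measureReal_def, uniformOn_univ, ENNReal.toReal_div, ← Nat.card_eq_fintype_card,
    Measure.count_apply (MeasurableSet.of_discrete), Nat.card_coe_set_eq,
    ← s.toFinite.cast_ncard_eq]
  rfl

variable {n : ℕ}

theorem rootedLaw_real_singleton (m : RootedMap n) :
    (rootedLaw n).real {m} = 1 / Nat.card (RootedMap n) := by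
  rw [rootedLaw, uniformOn_univ_real]
  simp

theorem card_preimage_forget (q : RootedMap n) :
    Nat.card (PointedMap.forget ⁻¹' {q} : Set (PointedMap n)) = q.numVertices := by
  obtain ⟨m, rfl⟩ : ∃ m : LabelledRootedMap n, m.toRootedMap = q := Quotient.exists_rep q
  exact m.card_pointed_fiber

theorem pointedLaw_real_singleton (m : RootedMap n) :
    (pointedLaw n).real {m} = m.numVertices / Nat.card (PointedMap n) := by
  rw [pointedLaw, map_measureReal_apply (Measurable.of_discrete) (measurableSet_singleton m),
    uniformOn_univ_real, card_preimage_forget]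

variable [Fintype (RootedMap n)]

theorem card_rootedMap_pos (hn : n ≠ 0) : 0 < (Nat.card (RootedMap n) : ℝ) := by
  have h := (binomMoment_relations n).1
  rw [← sum_choose_numVertices hn] at h
  simp only [Nat.choose_zero_right, Nat.cast_one, Finset.sum_const, Finset.card_univ,
    nsmul_eq_mul, mul_one, ← Nat.card_eq_fintype_card] at h
  exact_mod_cast h

theorem sum_numVertices (hn : n ≠ 0) : ∑ m : RootedMap n, (m.numVertices : ℝ) =
    (n + 2) / 2 * Nat.card (RootedMap n) := by
  have h := (binomMoment_relations n).2.1
  rw [← sum_choose_numVertices hn, ← sum_choose_numVertices hn] at h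
  simp only [Nat.choose_zero_right, Nat.choose_one_right, Nat.cast_one, Finset.sum_const,
    Finset.card_univ, nsmul_eq_mul, mul_one, ← Nat.card_eq_fintype_card] at h
  have h' : 2 * ∑ m : RootedMap n, (m.numVertices : ℝ) = (n + 2) * Nat.card (RootedMap n) := by
    exact_mod_cast h
  linarith

/-- The variance of the number of vertices of a uniform rooted map is at most `(n + 2) / 4`. -/
theorem sum_sq_numVertices_sub_le (hn : n ≠ 0) :
    ∑ m : RootedMap n, ((m.numVertices : ℝ) - ((n : ℝ) + 2) / 2) ^ (2 : ℕ) ≤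
      ((n : ℝ) + 2) / 4 * (Nat.card (RootedMap n) : ℝ) := by
  have h := (binomMoment_relations n).2.2
  rw [← sum_choose_numVertices hn, ← sum_choose_numVertices hn] at h
  simp only [Nat.choose_one_right, Nat.cast_choose_two] at h
  have h' : 4 * ∑ m : RootedMap n, ((m.numVertices : ℝ) * (m.numVertices - 1) / 2) ≤
      (n + 1) * ∑ m : RootedMap n, (m.numVertices : ℝ) := by
    exact_mod_cast h
  have h1 := sum_numVertices hn
  have h2 : ∑ m : RootedMap n, ((m.numVertices : ℝ) - (n + 2) / 2) ^ 2 =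
      2 * ∑ m : RootedMap n, ((m.numVertices : ℝ) * (m.numVertices - 1) / 2) -
        (n + 1) * ∑ m : RootedMap n, (m.numVertices : ℝ) +
        ((n + 2) / 2) ^ 2 * Nat.card (RootedMap n) := by
    rw [Nat.card_eq_fintype_card, ← Finset.card_univ, mul_comm _ ((Finset.univ).card : ℝ),
      ← nsmul_eq_mul, ← Finset.sum_const, Finset.mul_sum, Finset.mul_sum,
      ← Finset.sum_sub_distrib, ← Finset.sum_add_distrib]
    exact Finset.sum_congr rfl fun m _ => by ring
  rw [h2]
  rw [h1] at h' ⊢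
  linarith

/-- With N rooted maps and mean c = (n+2)/2, the masses of a map with V vertices are 1/N and V/(cN).
Cauchy–Schwarz bounds the mean of |V − c|/c by √((n+2)/4)/c = 1/√(n+2). -/
theorem tvNorm_rootedLaw_sub_pointedLaw_le (hn : n ≠ 0) :
    tvNorm ((rootedLaw n).toSignedMeasure - (pointedLaw n).toSignedMeasure) ≤
      √(1 / (n + 2 : ℝ)) := by
  refine (tvNorm_le_sum_singleton _).trans (Real.le_sqrt_of_sq_le ?_)
  have hN := card_rootedMap_pos hn
  set N : ℝ := (Nat.card (RootedMap n) : ℝ)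
  set c : ℝ := (n + 2) / 2 with hc
  have hc0 : 0 < c := by positivity
  have h1 : (Nat.card (PointedMap n) : ℝ) = c * N := by
    rw [card_pointedMap, Nat.cast_sum, sum_numVertices hn]
  have h2 : ∀ m : RootedMap n,
      |((rootedLaw n).toSignedMeasure - (pointedLaw n).toSignedMeasure) {m}| =
        (c * N)⁻¹ * |(m.numVertices : ℝ) - c| := by
    intro m
    rw [Measure.toSignedMeasure_sub_apply (measurableSet_singleton m), rootedLaw_real_singleton,
      pointedLaw_real_singleton, h1, ← abs_of_pos (inv_pos.2 (mul_pos hc0 hN)), ← abs_mul,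
      abs_sub_comm]
    congr 1
    change _ / (c * N) - 1 / N = _
    field_simp
  rw [Finset.sum_congr rfl fun m _ => h2 m, ← Finset.mul_sum, mul_pow]
  have h3 := sq_sum_le_card_mul_sum_sq (s := Finset.univ)
    (f := fun m : RootedMap n => |(m.numVertices : ℝ) - c|)
  simp only [sq_abs, Finset.card_univ, ← Nat.card_eq_fintype_card] at h3
  have h4 := h3.trans (mul_le_mul_of_nonneg_left (sum_sq_numVertices_sub_le hn) hN.le)
  refine (mul_le_mul_of_nonneg_left h4 (by positivity)).trans (le_of_eq ?_)
  rw [hc]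
  change (((n : ℝ) + 2) / 2 * N)⁻¹ ^ 2 * (N * ((n + 2) / 4 * N)) = _
  field_simp
  norm_num

/-- Since 2V/n − 1 = (2/n)((V − c) + 1) with c = (n+2)/2 the mean of V, the mean square is 4(Var V +
1)/n², at most (n + 6)/n². -/
theorem eLpNorm_numVertices_le (hn : n ≠ 0) :
    eLpNorm (fun m : RootedMap n => 2 * (m.numVertices : ℝ) / n - 1) 2 (rootedLaw n) ≤
      ENNReal.ofReal √((n + 6) / (n : ℝ) ^ 2) := by
  rw [MemLp.eLpNorm_eq_integral_rpow_norm two_ne_zero ENNReal.ofNat_ne_top MemLp.of_discrete]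
  refine ENNReal.ofReal_le_ofReal ?_
  rw [ENNReal.toReal_ofNat, ← one_div, ← Real.sqrt_eq_rpow]
  refine Real.sqrt_le_sqrt ?_
  have hN := card_rootedMap_pos hn
  have hn' : (n : ℝ) ≠ 0 := Nat.cast_ne_zero.2 hn
  rw [integral_fintype .of_finite]
  simp only [rootedLaw_real_singleton, smul_eq_mul, Real.rpow_two, Real.norm_eq_abs, sq_abs]
  rw [← Finset.mul_sum]
  have h1 := sum_numVertices hn
  have h2 := sum_sq_numVertices_sub_le hn
  have h3 : ∑ m : RootedMap n, (2 * (m.numVertices : ℝ) / n - 1) ^ 2 =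
      4 / (n : ℝ) ^ 2 * (∑ m : RootedMap n, ((m.numVertices : ℝ) - (n + 2) / 2) ^ 2 +
        2 * ∑ m : RootedMap n, (m.numVertices : ℝ) - (n + 1) * Nat.card (RootedMap n)) := by
    rw [Nat.card_eq_fintype_card, ← Finset.card_univ, mul_comm _ ((Finset.univ).card : ℝ),
      ← nsmul_eq_mul, ← Finset.sum_const, Finset.mul_sum, ← Finset.sum_add_distrib,
      ← Finset.sum_sub_distrib, Finset.mul_sum]
    refine Finset.sum_congr rfl fun m _ => ?_
    field_simp
    ring
  rw [h3, h1, one_div, inv_mul_le_iff₀ hN]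
  have h4 : (Nat.card (RootedMap n) : ℝ) * ((n + 6) / (n : ℝ) ^ 2) =
      4 / (n : ℝ) ^ 2 * ((n + 6) / 4 * Nat.card (RootedMap n)) := by
    ring
  rw [h4]
  refine mul_le_mul_of_nonneg_left ?_ (by positivity)
  linarith

end Measures

theorem mainTheorem3 :
    Tendsto (fun n : ℕ => tvNorm ((rootedLaw n).toSignedMeasure - (pointedLaw n).toSignedMeasure))
      atTop (𝓝 0) ∧
    Tendsto (fun n : ℕ =>
      eLpNorm (fun m : RootedMap n => 2 * (m.numVertices : ℝ) / n - 1) 2 (rootedLaw n))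
      atTop (𝓝 0) := by
  have hinv : Tendsto (fun n : ℕ => 1 / (n : ℝ)) atTop (𝓝 0) :=
    tendsto_one_div_atTop_nhds_zero_nat
  constructor
  · have h : Tendsto (fun n : ℕ => √(1 / ((n : ℝ) + 2))) atTop (𝓝 0) := by
      rw [← Real.sqrt_zero]
      refine (Real.continuous_sqrt.tendsto 0).comp ?_
      have := hinv.comp (tendsto_add_atTop_nat 2)
      simpa [Function.comp_def] using this
    refine tendsto_of_tendsto_of_tendsto_of_le_of_le' tendsto_const_nhds h
      (Eventually.of_forall fun n => measureReal_nonneg) ?_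
    filter_upwards [eventually_ne_atTop 0] with n hn
    have := Fintype.ofFinite (RootedMap n)
    exact tvNorm_rootedLaw_sub_pointedLaw_le hn
  · have h : Tendsto (fun n : ℕ => ENNReal.ofReal √((n + 6) / (n : ℝ) ^ 2)) atTop (𝓝 0) := by
      rw [← ENNReal.ofReal_zero, ← Real.sqrt_zero]
      refine ENNReal.tendsto_ofReal ((Real.continuous_sqrt.tendsto 0).comp ?_)
      have h1 : Tendsto (fun n : ℕ => 1 / (n : ℝ) + 6 * (1 / (n : ℝ)) ^ 2) atTop (𝓝 0) := by
        simpa using hinv.add ((hinv.pow 2).const_mul 6)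
      refine h1.congr' ?_
      filter_upwards [eventually_ne_atTop 0] with n hn
      have hn' : (n : ℝ) ≠ 0 := Nat.cast_ne_zero.2 hn
      field_simp
    refine tendsto_of_tendsto_of_tendsto_of_le_of_le' tendsto_const_nhds h
      (Eventually.of_forall fun n => bot_le) ?_
    filter_upwards [eventually_ne_atTop 0] with n hn
    have := Fintype.ofFinite (RootedMap n)
    exact eLpNorm_numVertices_le hn
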